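/- Let $n\ge 1$ and $[0,n]=\{0,1,\dots,n\}$. **Skewed binary partitions.** A *skewed binary partition* of $[0,n]$ is a tuple $\mathcal B=(B_{-1},B_0,B_1,\dots,B_p)$, $p\ge 0$, of pairwise disjoint subsets with union $[0,n]$, each marked homogeneous or non-homogeneous, such that: $B_{-1}$ is non-homogeneous; $B_0$ is homogeneous if $|B_0|\ge 2$; $0\in B_{-1}\cup B_0$; if $0\in B_{-1}$, then $|B_{-1}|\ge 2$ and $B_0=\emptyset$; every block with at most one element is non-homogeneous; $B_i\ne\emptyset$ for $1\le i\le p$. Its preorder $\preceq_{\mathcal B}$ on $[0,n]$ is: $x\preceq_{\mathcal B} y$ iff $x=y$, or $x\in B_i$ and $y\in B_j$ with $i<j$, or $x,y$ lie in the same homogeneous block. A preorder is a *contraction* of another one if it is obtained from it by a finite (possibly empty) sequence of steps, each of which contracts an edge of the Hasse diagram of the poset of equivalence classes, that is, picks $x,y$ such that $y$ covers $x$, adds the relation $y\preceq x$ and takes the reflexive transitive closure. $\mathcal B$ is a contraction of $\mathcal A$ if $\preceq_{\mathcal B}$ is a contraction of $\preceq_{\mathcal A}$. **Types.** Besides plain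 numbers $i$ we use the symbols $i^\circ$ and $i^\star$ ($i\in\mathbb N$), with $|i|=|i^\circ|=|i^\star|=i$; the three symbols are different, in particular $0\ne 0^\circ$. Let $\mathbb P$ be the set of plain positive integers and $\mathbb P^\star=\{i^\star: i\ge 1\}$. A *skewed binary composition* of $n$ is a tuple $(b_{-1},b_0,\dots,b_p)$ with $\sum_i|b_i|=n$, such that either $b_{-1}\in\mathbb N$ and $b_0=h^\circ$ for some $h\in\mathbb N$, or $b_{-1}\in\mathbb P$ and $b_0=0$; and for $1\le i\le p$ either $b_i\in\mathbb P$ or $b_i=c^\star$ with $c\ge 2$. The *type* $\operatorname{type}(\mathcal B)=(b_{-1},b_0,\dots,b_p)$ is given by: for $1\le i\le p$, $b_i=|B_i|$ if $B_i$ is non-homogeneous and $b_i=|B_i|^\star$ if $B_i$ is homogeneous; if $0\in B_0$, then $b_{-1}=|B_{-1}|$ and $b_0=(|B_0|-1)^\circ$; if $0\in B_{-1}$, then $b_{-1}=|B_{-1}|-1$ and $b_0=0$. **Multiplicity vectors and $\mathcal{SBP}(\mathbf m)$.** $\mathbf m=(m_0,\dots,m_\ell)$ is a *multiplicity vector* of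 magnitude $n$ if there is a nonzero real vector $0\le u_1\le\dots\le u_n$ with exactly $\ell$ distinct positive entries $d_1<\dots<d_\ell$ such that $0$ occurs $m_0$ times and $d_i$ occurs $m_i$ times in it. Let $r=m_1+\dots+m_\ell$. Let $\Omega_{\mathbf m}=\{\mathbf a_0,\dots,\mathbf a_r\}$, where $\mathbf a_0=(m_0,0,m_1,\dots,m_\ell)$ if $m_0>0$ and $\mathbf a_0=(0,0^\circ,m_1,\dots,m_\ell)$ if $m_0=0$; for $1\le i<r$, $\mathbf a_i=(m_0+i,0^\circ,m_1+\dots+m_g-i,m_{g+1},\dots,m_\ell)$ with $g\in\{1,\dots,\ell\}$ determined by $m_1+\dots+m_{g-1}\le i<m_1+\dots+m_g$; and $\mathbf a_r=(n,0^\circ)$. $\mathcal{SBP}(\mathbf m)$ is the set of all skewed binary partitions of $[0,n]$ that are contractions of a skewed binary partition $\mathcal A$ of $[0,n]$ with $\operatorname{type}(\mathcal A)\in\Omega_{\mathbf m}$. **Proposition.** Let $\mathbf m=(m_0,\dots,m_\ell)$ be a multiplicity vector of magnitude $n$ and $\mathcal B$ a skewed binary partition of $[0,n]$. Then $\mathcal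 B\in\mathcal{SBP}(\mathbf m)$ if and only if $\operatorname{type}(\mathcal B)=(b_{-1},b_0,\dots,b_p)$ is a skewed binary composition of $n$ that satisfies the following conditions. 1. $0<|b_{-1}|+|b_0|\le m_0$ if and only if $b_0=0$. 2. $m_0<|b_{-1}|+|b_0|+|b_1|$ (read as $m_0<|b_{-1}|+|b_0|$ if $p=0$), and for every $i\in\{1,\dots,\ell\}$ there is at most one $j\in\{1,\dots,p\}$ such that $$m_0+\dots+m_{i-1}\le |b_{-1}|+\dots+|b_{j-1}|<|b_{-1}|+\dots+|b_j|\le m_0+\dots+m_i.\qquad(*)$$ 3. For every $j\in\{1,\dots,p\}$: if $(*)$ holds for some $i\in\{1,\dots,\ell\}$, then $b_j\in\mathbb P$; otherwise $b_j\in\mathbb P^\star$. -/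

import Mathlib

namespace ParkingFan

/-- The sum of the entries of the tuple `f` over the positions `a ≤ t < b` (positions counted
from `0`). -/
def segSum {N : ℕ} (f : Fin N → ℕ) (a b : ℕ) : ℕ :=
  ∑ t : Fin N with a ≤ t.val ∧ t.val < b, f t

/-! ### Preorders and their contractions -/

/-- `y` covers `x` in the preposet given by the preorder `r`: `x` is strictly below `y` and no
element is strictly between them, i.e. the class of `x` and the class of `y` are joined by an edge
of the Hasse diagram of the poset of equivalence classes. -/
def Covers {α : Type*} (r : α → α → Prop) (x y : α) : Prop :=
  (r x y ∧ ¬ r y x) ∧ ¬ ∃ z, (r x z ∧ ¬ r z x) ∧ (r z y ∧ ¬ r y z)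

/-- The preorder obtained from `r` by contracting the Hasse edge between the class of `x` and the
class of `y` (where `y` covers `x`): the two classes are merged, so that the relation `y ≤ x`
is added and the reflexive transitive closure is taken. -/
def contractEdge {α : Type*} (r : α → α → Prop) (x y : α) : α → α → Prop :=
  Relation.ReflTransGen (fun a b => r a b ∨ (a = y ∧ b = x))

/-- The preorder `s` is a contraction of the preorder `r`: it is obtained from `r` by a finite
(possibly empty) sequence of contractions of edges of Hasse diagrams. -/
def IsContraction {α : Type*} (s r : α → α → Prop) : Prop :=
  Relation.ReflTransGen
    (fun r₁ r₂ : α → α → Prop => ∃ x y, Covers r₁ x y ∧ r₂ = contractEdge r₁ x y) r s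

/-! ### Skewed binary partitions -/

/-- A skewed binary partition `(B_{-1}, B_0, …, B_p)` of `[0,n]`, where `[0,n]` is `Fin (n + 1)`.
Positions are shifted by one: `block 0` is `B_{-1}`, `block 1` is `B_0`, and in general
`block (j + 1)` is `B_j`. The flag `homog` tells which blocks are homogeneous; an empty block
carries the flag `false`. -/
structure SkewedBinaryPartition (n : ℕ) where
  p : ℕ
  block : Fin (p + 2) → Finset (Fin (n + 1))
  homog : Fin (p + 2) → Bool
  disjoint : ∀ i j, i ≠ j → Disjoint (block i) (block j)
  cover : ∀ x, ∃ i, x ∈ block i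
  first_nonhomog : homog 0 = false
  second_homog : 2 ≤ (block 1).card → homog 1 = true
  zero_mem : 0 ∈ block 0 ∨ 0 ∈ block 1
  zero_mem_first : 0 ∈ block 0 → 2 ≤ (block 0).card ∧ block 1 = ∅
  small_nonhomog : ∀ i, (block i).card ≤ 1 → homog i = false
  nonempty : ∀ i : Fin (p + 2), 2 ≤ i.val → (block i).Nonempty

/-- The preorder `⪯_B` on `[0,n]`: elements of earlier blocks are below elements of later blocks,
all elements of a homogeneous block are equivalent, and distinct elements of a non-homogeneous
block are incomparable. (Empty blocks have no influence.) -/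
def SkewedBinaryPartition.rel {n : ℕ} (B : SkewedBinaryPartition n) (x y : Fin (n + 1)) : Prop :=
  x = y ∨ (∃ i j, i < j ∧ x ∈ B.block i ∧ y ∈ B.block j) ∨
    ∃ i, B.homog i = true ∧ x ∈ B.block i ∧ y ∈ B.block i

/-! ### Skewed binary compositions and types -/

/-- Entries of skewed binary compositions: a plain number `i`, or one of its two decorated
variants `i°` and `i⋆`. -/
inductive Entry where
  | plain (i : ℕ)
  | circ (i : ℕ)
  | star (i : ℕ)

/-- The numerical value `|i| = |i°| = |i⋆| = i`. -/
def Entry.abs : Entry → ℕ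
  | .plain i => i
  | .circ i => i
  | .star i => i

/-- The entry is a plain positive integer. -/
def Entry.IsPos (e : Entry) : Prop := ∃ c, 0 < c ∧ e = .plain c

/-- The entry is a starred positive integer. -/
def Entry.IsPosStar (e : Entry) : Prop := ∃ c, 0 < c ∧ e = .star c

/-- `b = (b_{-1}, b_0, …, b_p)` is a skewed binary composition of `n`
(`b_j` stands at position `j + 1`). -/
def IsSkewedBinaryComposition (n : ℕ) {p : ℕ} (b : Fin (p + 2) → Entry) : Prop :=
  ∑ i, (b i).abs = n ∧
  ((∃ c h, b 0 = .plain c ∧ b 1 = .circ h) ∨ (∃ c, 0 < c ∧ b 0 = .plain c ∧ b 1 = .plain 0)) ∧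
  ∀ i : Fin (p + 2), 2 ≤ i.val →
    (∃ c, 1 ≤ c ∧ b i = .plain c) ∨ (∃ c, 2 ≤ c ∧ b i = .star c)

/-- The type `(b_{-1}, b_0, …, b_p)` of a skewed binary partition. -/
def SkewedBinaryPartition.type {n : ℕ} (B : SkewedBinaryPartition n) (i : Fin (B.p + 2)) : Entry :=
  if i = 0 then
    if 0 ∈ B.block 1 then .plain (B.block 0).card else .plain ((B.block 0).card - 1)
  else if i = 1 then
    if 0 ∈ B.block 1 then .circ ((B.block 1).card - 1) else .plain (B.block 1).card
  else
    if B.homog i = true then .star (B.block i).card else .plain (B.block i).card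

/-! ### Multiplicity vectors and `SBP(m)` -/

/-- `m = (m_0, …, m_ℓ)` is a multiplicity vector of magnitude `n`: there is a nonzero vector
`0 ≤ u_1 ≤ ⋯ ≤ u_n` whose distinct positive entries are `d_1 < ⋯ < d_ℓ`, such that `0` occurs `m_0`
times and `d_i` occurs `m_i` times in `u`. -/
def IsMultiplicityVector (n : ℕ) {ℓ : ℕ} (m : Fin (ℓ + 1) → ℕ) : Prop :=
  ∃ (u : Fin n → ℝ) (d : Fin ℓ → ℝ),
    Monotone u ∧ (∀ j, 0 ≤ u j) ∧ u ≠ 0 ∧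
    StrictMono d ∧ (∀ x : ℝ, x ∈ Set.range d ↔ 0 < x ∧ x ∈ Set.range u) ∧
    m 0 = Nat.card {j // u j = 0} ∧
    ∀ i : Fin ℓ, m i.succ = Nat.card {j // u j = d i}

/-- The set `Ω_m` of the skewed binary compositions `a_0, …, a_r`, `r = m_1 + ⋯ + m_ℓ`
(as lists of entries). -/
def Omega {ℓ : ℕ} (m : Fin (ℓ + 1) → ℕ) : Set (List Entry) :=
  { a |
    -- `a_0`
    (0 < m 0 ∧ a = .plain (m 0) :: .plain 0 :: ((List.ofFn m).drop 1).map .plain) ∨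
    (m 0 = 0 ∧ a = .plain 0 :: .circ 0 :: ((List.ofFn m).drop 1).map .plain) ∨
    -- `a_i` for `1 ≤ i < r`
    (∃ i g : ℕ, 1 ≤ i ∧ 1 ≤ g ∧ g ≤ ℓ ∧ segSum m 1 g ≤ i ∧ i < segSum m 1 (g + 1) ∧
      a = .plain (m 0 + i) :: .circ 0 :: .plain (segSum m 1 (g + 1) - i) ::
        ((List.ofFn m).drop (g + 1)).map .plain) ∨
    -- `a_r`
    a = [.plain (∑ t, m t), .circ 0] }

/-- `SBP(m)`: the skewed binary partitions of `[0,n]` that are contractions of a skewed binary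
partition whose type lies in `Ω_m`. -/
def SBP (n : ℕ) {ℓ : ℕ} (m : Fin (ℓ + 1) → ℕ) : Set (SkewedBinaryPartition n) :=
  { B | ∃ A : SkewedBinaryPartition n, List.ofFn A.type ∈ Omega m ∧ IsContraction B.rel A.rel }

/-! ### The inequalities between partial sums -/

/-- For positive `i ≤ ℓ` and `j ≤ p`:
`m_0 + ⋯ + m_{i-1} ≤ |b_{-1}| + ⋯ + |b_{j-1}| < |b_{-1}| + ⋯ + |b_j| ≤ m_0 + ⋯ + m_i`. -/
def Fits {ℓ p : ℕ} (m : Fin (ℓ + 1) → ℕ) (b : Fin (p + 2) → Entry) (i j : ℕ) : Prop :=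
  (1 ≤ i ∧ i ≤ ℓ) ∧ (1 ≤ j ∧ j ≤ p) ∧
  segSum m 0 i ≤ segSum (fun t => (b t).abs) 0 (j + 1) ∧
  segSum (fun t => (b t).abs) 0 (j + 1) < segSum (fun t => (b t).abs) 0 (j + 2) ∧
  segSum (fun t => (b t).abs) 0 (j + 2) ≤ segSum m 0 (i + 1)

end ParkingFan

/-! A partition with type in Ω_m has no homogeneous blocks, so its partial order is given by a level
function `lam`: x < y iff `lam x < lam y`. One number K records where 0 sits: K = m_0 for a_0 and K
= m_0 + i for a_i. The levels up to i + 1 contain max(m_0 + ⋯ + m_i, K) + 1 elements, the extra one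
being 0. If K = m_0, then 0 shares level 1 with m_0 others; if K > m_0, then K elements have level 0
and 0 alone has level 1. Conversely, every such level function arises from Ω_m (`exists_isLevel`,
`IsLevel.exists_partition`).

Contractions are recognised without following their steps. For a finite layered partial order r, a
preorder s is a contraction of r exactly when `Refines r s` holds: s contains r, every nontrivial
s-class contains a strict r-pair, and between trivial s-classes s adds nothing to r. The criterion
survives each contraction (`IsContraction.refines`); conversely, edges whose reverse lies in s can
be contracted until s is reached (`Refines.isContraction`).

For B this gives `mem_SBP_iff`: a homogeneous block meets two levels, and elements of distinct
non-homogeneous blocks have strictly increasing levels. Now list the elements block by block and cut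
the list after the levels. A non-homogeneous B_j with j ≥ 1 lies in one segment, which is (*), and
distinct ones use distinct segments; a homogeneous one straddles a cut, so (*) fails. Condition 1
and the first half of condition 2 describe the blocks near 0. Conversely, when the conditions hold,
cutting a list sorted by blocks produces the required levels (`exists_levelContraction`). -/

namespace ParkingFan

/-! ### Layered preorders -/

/-- The preorder in which `f` is a rank function: elements of smaller rank are below elements of
larger rank, and the elements of rank `c` are equivalent if `h c`, an antichain otherwise. -/
def layerRel {α : Type*} (f : α → ℚ) (h : ℚ → Prop) (x y : α) : Prop :=
  x = y ∨ f x < f y ∨ (f x = f y ∧ h (f x))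

theorem layerRel_trans {α : Type*} {f : α → ℚ} {h : ℚ → Prop} {x y z : α}
    (hxy : layerRel f h x y) (hyz : layerRel f h y z) : layerRel f h x z := by
  rcases hxy with rfl | hxy | ⟨hxy, h1⟩
  · exact hyz
  · rcases hyz with rfl | hyz | ⟨hyz, h2⟩
    · exact Or.inr (Or.inl hxy)
    · exact Or.inr (Or.inl (hxy.trans hyz))
    · exact Or.inr (Or.inl (hyz ▸ hxy))
  · rcases hyz with rfl | hyz | ⟨hyz, h2⟩
    · exact Or.inr (Or.inr ⟨hxy, h1⟩)
    · exact Or.inr (Or.inl (hxy ▸ hyz))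
    · exact Or.inr (Or.inr ⟨hxy.trans hyz, h1⟩)

theorem layerRel_not_symm_iff {α : Type*} {f : α → ℚ} {h : ℚ → Prop} {x y : α} :
    layerRel f h x y ∧ ¬ layerRel f h y x ↔ f x < f y := by
  constructor
  · rintro ⟨rfl | hxy | ⟨hxy, h1⟩, hn⟩
    · exact absurd (Or.inl rfl) hn
    · exact hxy
    · exact absurd (Or.inr (Or.inr ⟨hxy.symm, hxy ▸ h1⟩)) hn
  · intro hxy
    refine ⟨Or.inr (Or.inl hxy), ?_⟩
    rintro (rfl | hyx | ⟨hyx, -⟩)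
    · exact lt_irrefl _ hxy
    · exact lt_asymm hxy hyx
    · exact hxy.ne' hyx

theorem layerRel_symm_eq {α : Type*} {f : α → ℚ} {h : ℚ → Prop} {x y : α}
    (hxy : layerRel f h x y) (hyx : layerRel f h y x) : f x = f y := by
  by_contra hne
  rcases lt_or_gt_of_ne hne with hlt | hlt
  · exact (layerRel_not_symm_iff.2 hlt).2 hyx
  · exact (layerRel_not_symm_iff.2 hlt).2 hxy

theorem covers_layerRel {α : Type*} {f : α → ℚ} {h : ℚ → Prop} {x y : α} :
    Covers (layerRel f h) x y ↔ f x < f y ∧ ∀ z, ¬ (f x < f z ∧ f z < f y) := by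
  simp only [Covers, layerRel_not_symm_iff, not_exists]

open Classical in
/-- The rank function after contracting the edge between `x` and `y`: their classes are moved to
the midpoint of their ranks. -/
noncomputable def mergeRank {α : Type*} (f : α → ℚ) (h : ℚ → Prop) (x y z : α) : ℚ :=
  if (layerRel f h x z ∧ layerRel f h z x) ∨ (layerRel f h y z ∧ layerRel f h z y) then
    (f x + f y) / 2 else f z

/-- The homogeneous ranks after contracting the edge between `x` and `y`. -/
def mergeHomog {α : Type*} (f : α → ℚ) (h : ℚ → Prop) (x y : α) (c : ℚ) : Prop :=
  c = (f x + f y) / 2 ∨ h c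

/-- Since `y` covers `x`, no rank lies strictly between theirs, so the midpoint is free and marks
exactly the merged class. Rational ranks make room for it without renumbering. -/
theorem mergeRank_eq_mid_iff {α : Type*} {f : α → ℚ} {h : ℚ → Prop} {x y z : α}
    (hc : Covers (layerRel f h) x y) :
    mergeRank f h x y z = (f x + f y) / 2 ↔
      (layerRel f h x z ∧ layerRel f h z x) ∨ (layerRel f h y z ∧ layerRel f h z y) := by
  rw [covers_layerRel] at hc
  unfold mergeRank
  split_ifs with hz
  · simp [hz]
  · simp only [hz, iff_false]
    intro he
    exact hc.2 z ⟨by linarith [hc.1], by linarith [hc.1]⟩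

theorem mergeRank_of_not {α : Type*} {f : α → ℚ} {h : ℚ → Prop} {x y z : α}
    (hz : ¬ ((layerRel f h x z ∧ layerRel f h z x) ∨ (layerRel f h y z ∧ layerRel f h z y))) :
    mergeRank f h x y z = f z := by
  unfold mergeRank
  rw [if_neg hz]

/-- Moving to the midpoint crosses no occupied rank. Elements left behind at the rank of `x` end up
below the merged class, those at the rank of `y` above it, as the closure demands. -/
theorem layerRel_le_merge {α : Type*} {f : α → ℚ} {h : ℚ → Prop} {x y a b : α}
    (hc : Covers (layerRel f h) x y) (hab : layerRel f h a b) :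
    layerRel (mergeRank f h x y) (mergeHomog f h x y) a b := by
  have hc' := covers_layerRel.1 hc
  by_cases ha : (layerRel f h x a ∧ layerRel f h a x) ∨ (layerRel f h y a ∧ layerRel f h a y)
  · have ha' := (mergeRank_eq_mid_iff hc).2 ha
    by_cases hb : (layerRel f h x b ∧ layerRel f h b x) ∨ (layerRel f h y b ∧ layerRel f h b y)
    · have hb' := (mergeRank_eq_mid_iff hc).2 hb
      exact Or.inr (Or.inr ⟨ha'.trans hb'.symm, Or.inl ha'⟩)
    · have hb' := mergeRank_of_not hb
      refine Or.inr (Or.inl ?_)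
      rw [ha', hb']
      by_contra hlt
      have hbx : f b ≤ f x := by
        by_contra hbx
        exact hc'.2 b ⟨by linarith, by linarith [hc'.1]⟩
      rcases ha with ⟨h1, h2⟩ | ⟨h1, h2⟩
      · have hxb := layerRel_trans h1 hab
        refine hb (Or.inl ⟨hxb, ?_⟩)
        by_contra hbx'
        exact absurd (layerRel_not_symm_iff.1 ⟨hxb, hbx'⟩) (not_lt.2 hbx)
      · have hyb := layerRel_trans h1 hab
        exact (layerRel_not_symm_iff.2 (lt_of_le_of_lt hbx hc'.1)).2 hyb
  · have ha' := mergeRank_of_not ha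
    by_cases hb : (layerRel f h x b ∧ layerRel f h b x) ∨ (layerRel f h y b ∧ layerRel f h b y)
    · have hb' := (mergeRank_eq_mid_iff hc).2 hb
      refine Or.inr (Or.inl ?_)
      rw [ha', hb']
      by_contra hlt
      have hya : f y ≤ f a := by
        by_contra hya
        exact hc'.2 a ⟨by linarith [hc'.1], by linarith⟩
      rcases hb with ⟨h1, h2⟩ | ⟨h1, h2⟩
      · have hax := layerRel_trans hab h2
        exact (layerRel_not_symm_iff.2 (lt_of_lt_of_le hc'.1 hya)).2 hax
      · have hay := layerRel_trans hab h2
        refine ha (Or.inr ⟨?_, hay⟩)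
        by_contra hya'
        exact absurd (layerRel_not_symm_iff.1 ⟨hay, hya'⟩) (not_lt.2 hya)
    · have hb' := mergeRank_of_not hb
      rcases hab with hab | hab | ⟨hab, hh⟩
      · exact Or.inl hab
      · exact Or.inr (Or.inl (by rwa [ha', hb']))
      · exact Or.inr (Or.inr ⟨by rwa [ha', hb'], Or.inr (by rwa [ha'])⟩)

/-- Contracting a Hasse edge of a layered preorder gives a layered preorder. -/
theorem contractEdge_layerRel {α : Type*} {f : α → ℚ} {h : ℚ → Prop} {x y : α}
    (hc : Covers (layerRel f h) x y) :
    contractEdge (layerRel f h) x y = layerRel (mergeRank f h x y) (mergeHomog f h x y) := by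
  have hc' := covers_layerRel.1 hc
  have rfl' : ∀ z, layerRel f h z z := fun z => Or.inl rfl
  funext a b
  apply propext
  constructor
  · intro hab
    induction hab with
    | refl => exact Or.inl rfl
    | tail _ hbc ih =>
      refine layerRel_trans ih ?_
      rcases hbc with hbc | ⟨rfl, rfl⟩
      · exact layerRel_le_merge hc hbc
      · have h1 := (mergeRank_eq_mid_iff hc).2 (Or.inr ⟨rfl' _, rfl' _⟩)
        have h2 := (mergeRank_eq_mid_iff hc).2 (Or.inl ⟨rfl' _, rfl' _⟩)
        exact Or.inr (Or.inr ⟨h1.trans h2.symm, Or.inl h1⟩)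
  · intro hab
    have base : ∀ {u v}, layerRel f h u v → contractEdge (layerRel f h) x y u v :=
      fun huv => Relation.ReflTransGen.single (Or.inl huv)
    have tr : ∀ {u v w}, contractEdge (layerRel f h) x y u v →
        contractEdge (layerRel f h) x y v w → contractEdge (layerRel f h) x y u w :=
      fun h1 h2 => Relation.ReflTransGen.trans h1 h2
    have hyx : contractEdge (layerRel f h) x y y x :=
      Relation.ReflTransGen.single (Or.inr ⟨rfl, rfl⟩)
    have hxy : contractEdge (layerRel f h) x y x y := base (Or.inr (Or.inl hc'.1))
    have tox : ∀ {u}, (layerRel f h x u ∧ layerRel f h u x) ∨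
        (layerRel f h y u ∧ layerRel f h u y) → contractEdge (layerRel f h) x y u x ∧
          contractEdge (layerRel f h) x y x u := by
      rintro u (⟨h1, h2⟩ | ⟨h1, h2⟩)
      · exact ⟨base h2, base h1⟩
      · exact ⟨tr (base h2) hyx, tr hxy (base h1)⟩
    by_cases ha : (layerRel f h x a ∧ layerRel f h a x) ∨ (layerRel f h y a ∧ layerRel f h a y)
    · by_cases hb : (layerRel f h x b ∧ layerRel f h b x) ∨ (layerRel f h y b ∧ layerRel f h b y)
      · exact tr (tox ha).1 (tox hb).2
      · refine tr (tox ha).1 ?_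
        have ha' := (mergeRank_eq_mid_iff hc).2 ha
        have hb' := mergeRank_of_not hb
        rcases hab with rfl | hab | ⟨hab, -⟩
        · exact absurd ha hb
        · rw [ha', hb'] at hab
          exact base (Or.inr (Or.inl (by linarith [hc'.1])))
        · exact absurd ((mergeRank_eq_mid_iff hc).1 (hab.symm.trans ha')) hb
    · have ha' := mergeRank_of_not ha
      by_cases hb : (layerRel f h x b ∧ layerRel f h b x) ∨ (layerRel f h y b ∧ layerRel f h b y)
      · refine tr (tr ?_ hyx) (tox hb).2
        have hb' := (mergeRank_eq_mid_iff hc).2 hb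
        rcases hab with rfl | hab | ⟨hab, -⟩
        · exact absurd hb ha
        · rw [ha', hb'] at hab
          exact base (Or.inr (Or.inl (by linarith [hc'.1])))
        · exact absurd ((mergeRank_eq_mid_iff hc).1 (hab.trans hb')) ha
      · have hb' := mergeRank_of_not hb
        refine base ?_
        rcases hab with hab | hab | ⟨hab, hh⟩
        · exact Or.inl hab
        · exact Or.inr (Or.inl (by rwa [ha', hb'] at hab))
        · rcases hh with hh | hh
          · exact absurd ((mergeRank_eq_mid_iff hc).1 hh) ha
          · exact Or.inr (Or.inr ⟨by rwa [ha', hb'] at hab, by rwa [ha'] at hh⟩)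

/-! ### A criterion for contractions of layered preorders -/

/-- The relations between a preorder `r` and a coarser preorder `s` that characterize
contractions of layered preorders. -/
structure Refines {α : Type*} (r s : α → α → Prop) : Prop where
  le : ∀ x y, r x y → s x y
  spread : ∀ x y, s x y → s y x → (r x y ∧ r y x) ∨
    ∃ u v, (s x u ∧ s u x) ∧ (s x v ∧ s v x) ∧ r u v ∧ ¬ r v u
  comp : ∀ x y, s x y → (∀ z, s x z → s z x → z = x) → (∀ z, s y z → s z y → z = y) → r x y

/-- The invariant behind necessity. Only the merged class is new, and it is never trivial, so `comp`
is inherited; `spread` needs a strict `r`-pair in that class. -/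
theorem Refines.contract {α : Type*} {r : α → α → Prop} {f : α → ℚ} {h : ℚ → Prop} {x y : α}
    (hr : ∀ a b, r a b → r b a → a = b) (hs : Refines r (layerRel f h))
    (hc : Covers (layerRel f h) x y) :
    Refines r (layerRel (mergeRank f h x y) (mergeHomog f h x y)) := by
  have hc' := covers_layerRel.1 hc
  have rfl' : ∀ z, layerRel f h z z := fun z => Or.inl rfl
  have moved : ∀ {a b}, mergeRank f h x y a = (f x + f y) / 2 →
      mergeRank f h x y b = (f x + f y) / 2 →
      layerRel (mergeRank f h x y) (mergeHomog f h x y) a b :=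
    fun h1 h2 => Or.inr (Or.inr ⟨h1.trans h2.symm, Or.inl h1⟩)
  have hx : mergeRank f h x y x = (f x + f y) / 2 :=
    (mergeRank_eq_mid_iff hc).2 (Or.inl ⟨rfl' _, rfl' _⟩)
  have hy : mergeRank f h x y y = (f x + f y) / 2 :=
    (mergeRank_eq_mid_iff hc).2 (Or.inr ⟨rfl' _, rfl' _⟩)
  -- If one of the two old classes is nontrivial, antisymmetry of `r` and `spread` give the pair
  -- inside it; if both are trivial, `comp` shows that `x`, `y` itself is such a pair.
  have pair : ∃ u v, mergeRank f h x y u = (f x + f y) / 2 ∧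
      mergeRank f h x y v = (f x + f y) / 2 ∧ r u v ∧ ¬ r v u := by
    have key : ∀ w, (w = x ∨ w = y) → ∀ z, layerRel f h w z → layerRel f h z w → z ≠ w →
        ∃ u v, mergeRank f h x y u = (f x + f y) / 2 ∧
          mergeRank f h x y v = (f x + f y) / 2 ∧ r u v ∧ ¬ r v u := by
      intro w hw z h1 h2 hne
      rcases hs.spread w z h1 h2 with ⟨h3, h4⟩ | ⟨u, v, hu, hv, huv⟩
      · exact absurd (hr _ _ h4 h3) hne
      · rcases hw with rfl | rfl
        · exact ⟨u, v, (mergeRank_eq_mid_iff hc).2 (Or.inl hu),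
            (mergeRank_eq_mid_iff hc).2 (Or.inl hv), huv⟩
        · exact ⟨u, v, (mergeRank_eq_mid_iff hc).2 (Or.inr hu),
            (mergeRank_eq_mid_iff hc).2 (Or.inr hv), huv⟩
    by_cases h1 : ∀ z, layerRel f h x z → layerRel f h z x → z = x
    · by_cases h2 : ∀ z, layerRel f h y z → layerRel f h z y → z = y
      · exact ⟨x, y, hx, hy, hs.comp x y hc.1.1 h1 h2, fun hyx => hc.1.2 (hs.le _ _ hyx)⟩
      · push Not at h2
        obtain ⟨z, h3, h4, h5⟩ := h2
        exact key y (Or.inr rfl) z h3 h4 h5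
    · push Not at h1
      obtain ⟨z, h3, h4, h5⟩ := h1
      exact key x (Or.inl rfl) z h3 h4 h5
  have old : ∀ {a b}, mergeRank f h x y a ≠ (f x + f y) / 2 →
      layerRel (mergeRank f h x y) (mergeHomog f h x y) a b →
      layerRel (mergeRank f h x y) (mergeHomog f h x y) b a →
      layerRel f h a b ∧ layerRel f h b a := by
    intro a b ha hab hba
    have he := layerRel_symm_eq hab hba
    have ha' := mergeRank_of_not (fun h => ha ((mergeRank_eq_mid_iff hc).2 h))
    have hb' := mergeRank_of_not (fun h => (he ▸ ha) ((mergeRank_eq_mid_iff hc).2 h))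
    rcases hab with rfl | hab | ⟨-, hh⟩
    · exact ⟨rfl' _, rfl' _⟩
    · exact absurd he hab.ne
    · rcases hh with hh | hh
      · exact absurd hh ha
      · rw [ha', hb'] at he
        rw [ha'] at hh
        exact ⟨Or.inr (Or.inr ⟨he, hh⟩), Or.inr (Or.inr ⟨he.symm, he ▸ hh⟩)⟩
  refine ⟨fun a b hab => layerRel_le_merge hc (hs.le a b hab), ?_, ?_⟩
  · intro a b hab hba
    by_cases ha : mergeRank f h x y a = (f x + f y) / 2
    · obtain ⟨u, v, hu, hv, huv⟩ := pair
      exact Or.inr ⟨u, v, ⟨moved ha hu, moved hu ha⟩, ⟨moved ha hv, moved hv ha⟩, huv⟩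
    · obtain ⟨h1, h2⟩ := old ha hab hba
      rcases hs.spread a b h1 h2 with h3 | ⟨u, v, hu, hv, huv⟩
      · exact Or.inl h3
      · exact Or.inr ⟨u, v, ⟨layerRel_le_merge hc hu.1, layerRel_le_merge hc hu.2⟩,
          ⟨layerRel_le_merge hc hv.1, layerRel_le_merge hc hv.2⟩, huv⟩
  · intro a b hab ha hb
    have notmid : ∀ {c}, (∀ z, layerRel (mergeRank f h x y) (mergeHomog f h x y) c z →
        layerRel (mergeRank f h x y) (mergeHomog f h x y) z c → z = c) →
        mergeRank f h x y c ≠ (f x + f y) / 2 := by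
      intro c hcz hmid
      have h1 := hcz x (moved hmid hx) (moved hx hmid)
      have h2 := hcz y (moved hmid hy) (moved hy hmid)
      have := hc'.1
      rw [h1, h2] at this
      exact lt_irrefl _ this
    have ha1 := notmid ha
    have hb1 := notmid hb
    have ha' := mergeRank_of_not (fun h => ha1 ((mergeRank_eq_mid_iff hc).2 h))
    have hb' := mergeRank_of_not (fun h => hb1 ((mergeRank_eq_mid_iff hc).2 h))
    refine hs.comp a b ?_ (fun z h1 h2 => ha z (layerRel_le_merge hc h1) (layerRel_le_merge hc h2))
      (fun z h1 h2 => hb z (layerRel_le_merge hc h1) (layerRel_le_merge hc h2))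
    rcases hab with hab | hab | ⟨hab, hh⟩
    · exact Or.inl hab
    · exact Or.inr (Or.inl (by rwa [ha', hb'] at hab))
    · rcases hh with hh | hh
      · exact absurd hh ha1
      · exact Or.inr (Or.inr ⟨by rwa [ha', hb'] at hab, by rwa [ha'] at hh⟩)

/-- Every contraction of a layered partial order satisfies the criterion. -/
theorem IsContraction.refines {α : Type*} {s : α → α → Prop} {f : α → ℚ} {h : ℚ → Prop}
    (hr : ∀ a b, layerRel f h a b → layerRel f h b a → a = b)
    (hs : IsContraction s (layerRel f h)) : Refines (layerRel f h) s := by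
  suffices H : ∃ F H, s = layerRel F H ∧ Refines (layerRel f h) (layerRel F H) by
    obtain ⟨F, H, rfl, h1⟩ := H
    exact h1
  induction hs with
  | refl => exact ⟨f, h, rfl, fun _ _ h => h, fun _ _ h1 h2 => Or.inl ⟨h1, h2⟩, fun _ _ h _ _ => h⟩
  | tail _ hst ih =>
    obtain ⟨F, H, rfl, h1⟩ := ih
    obtain ⟨x, y, hc, rfl⟩ := hst
    exact ⟨_, _, contractEdge_layerRel hc, h1.contract hr hc⟩

/-- The inductive step of sufficiency. In the `s`-class of `x`, either the two given elements both
lie in the merged class, or two different new ranks occur and supply a strict pair; every other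
`s`-class keeps its ranks. -/
theorem Refines.contract_left {α : Type*} {s : α → α → Prop} {f : α → ℚ} {h : ℚ → Prop} {x y : α}
    (st : ∀ a b c, s a b → s b c → s a c)
    (hs : Refines (layerRel f h) s) (hc : Covers (layerRel f h) x y) (hyx : s y x) :
    Refines (layerRel (mergeRank f h x y) (mergeHomog f h x y)) s := by
  have rfl' : ∀ z, layerRel f h z z := fun z => Or.inl rfl
  have sr : ∀ z, s z z := fun z => hs.le _ _ (rfl' z)
  have hxy : s x y := hs.le _ _ hc.1.1
  have hx : mergeRank f h x y x = (f x + f y) / 2 :=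
    (mergeRank_eq_mid_iff hc).2 (Or.inl ⟨rfl' _, rfl' _⟩)
  refine ⟨?_, ?_, fun a b h1 h2 h3 => layerRel_le_merge hc (hs.comp a b h1 h2 h3)⟩
  · intro a b hab
    rw [← contractEdge_layerRel hc] at hab
    induction hab with
    | refl => exact sr _
    | tail _ hbc ih =>
      refine st _ _ _ ih ?_
      rcases hbc with hbc | ⟨rfl, rfl⟩
      · exact hs.le _ _ hbc
      · exact hyx
  · intro a b hab hba
    have strict : ∀ {u v}, mergeRank f h x y u ≠ mergeRank f h x y v →
        (s a u ∧ s u a) → (s a v ∧ s v a) → ∃ u v, (s a u ∧ s u a) ∧ (s a v ∧ s v a) ∧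
          layerRel (mergeRank f h x y) (mergeHomog f h x y) u v ∧
            ¬ layerRel (mergeRank f h x y) (mergeHomog f h x y) v u := by
      intro u v hne hu hv
      rcases lt_or_gt_of_ne hne with hlt | hlt
      · exact ⟨u, v, hu, hv, layerRel_not_symm_iff.2 hlt⟩
      · exact ⟨v, u, hv, hu, layerRel_not_symm_iff.2 hlt⟩
    by_cases hax : s a x ∧ s x a
    · by_cases h1 : mergeRank f h x y a = mergeRank f h x y x
      · by_cases h2 : mergeRank f h x y b = mergeRank f h x y x
        · refine Or.inl ⟨Or.inr (Or.inr ⟨h1.trans h2.symm, Or.inl (h1.trans hx)⟩),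
            Or.inr (Or.inr ⟨h2.trans h1.symm, Or.inl (h2.trans hx)⟩)⟩
        · exact Or.inr (strict h2 ⟨hab, hba⟩ hax)
      · exact Or.inr (strict h1 ⟨sr _, sr _⟩ hax)
    · have stay : ∀ {u}, s a u ∧ s u a → mergeRank f h x y u = f u := by
        intro u hu
        apply mergeRank_of_not
        rintro (⟨h1, h2⟩ | ⟨h1, h2⟩)
        · exact hax ⟨st _ _ _ hu.1 (hs.le _ _ h2), st _ _ _ (hs.le _ _ h1) hu.2⟩
        · exact hax ⟨st _ _ _ (st _ _ _ hu.1 (hs.le _ _ h2)) hyx,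
            st _ _ _ hxy (st _ _ _ (hs.le _ _ h1) hu.2)⟩
      rcases hs.spread a b hab hba with ⟨h1, h2⟩ | ⟨u, v, hu, hv, huv⟩
      · exact Or.inl ⟨layerRel_le_merge hc h1, layerRel_le_merge hc h2⟩
      · refine Or.inr (strict (u := u) (v := v) ?_ hu hv)
        rw [stay hu, stay hv]
        exact (layerRel_not_symm_iff.1 huv).ne

/-- A preorder satisfying the criterion is a contraction. -/
theorem Refines.isContraction {α : Type*} [Finite α] {s : α → α → Prop}
    (st : ∀ a b c, s a b → s b c → s a c) (f : α → ℚ) (h : ℚ → Prop)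
    (hs : Refines (layerRel f h) s) : IsContraction s (layerRel f h) := by
  -- Each contraction adds at least the pair `(y, x)`, so the number of unrelated pairs drops.
  induction hN : Set.ncard {q : α × α | ¬ layerRel f h q.1 q.2} using Nat.strong_induction_on
    generalizing f h with
  | _ N ih =>
  by_cases hex : ∃ q : α × α, f q.1 < f q.2 ∧ s q.2 q.1
  -- Among the strict pairs reversed in `s`, one of smallest rank gap is a cover: an element in
  -- between would give a reversed pair with a smaller gap.
  · obtain ⟨q, hq, hmin⟩ := Set.exists_min_image {q : α × α | f q.1 < f q.2 ∧ s q.2 q.1}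
      (fun q => f q.2 - f q.1) (Set.toFinite _) hex
    obtain ⟨x, y⟩ := q
    obtain ⟨hlt, hyx⟩ := hq
    simp only at hlt hyx hmin
    have hc : Covers (layerRel f h) x y := by
      refine covers_layerRel.2 ⟨hlt, ?_⟩
      rintro z ⟨h1, h2⟩
      have hzx : s z x := st _ _ _ (hs.le _ _ (Or.inr (Or.inl h2))) hyx
      have := hmin (x, z) ⟨h1, hzx⟩
      simp only at this
      linarith
    have hstep : IsContraction (layerRel (mergeRank f h x y) (mergeHomog f h x y))
        (layerRel f h) :=
      Relation.ReflTransGen.single ⟨x, y, hc, (contractEdge_layerRel hc).symm⟩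
    refine Relation.ReflTransGen.trans hstep (ih _ ?_ _ _ (hs.contract_left st hc hyx) rfl)
    rw [← hN]
    apply Set.ncard_lt_ncard _ (Set.toFinite _)
    refine ⟨fun q hq hq' => hq (layerRel_le_merge hc hq'), fun hsub => ?_⟩
    have hm : (y, x) ∈ {q : α × α | ¬ layerRel f h q.1 q.2} := hc.1.2
    refine hsub hm ?_
    rw [← contractEdge_layerRel hc]
    exact Relation.ReflTransGen.single (Or.inr ⟨rfl, rfl⟩)
  -- With no reversed pair left, the second alternative of `spread` is impossible, so both preorders
  -- have the same classes.
  · have classes : ∀ a b, s a b → s b a → layerRel f h a b ∧ layerRel f h b a := by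
      intro a b hab hba
      rcases hs.spread a b hab hba with h1 | ⟨u, v, hu, hv, huv⟩
      · exact h1
      · exact absurd ⟨(u, v), layerRel_not_symm_iff.1 huv, st _ _ _ hv.2 hu.1⟩ hex
    have homog : ∀ {a z}, s a z → s z a → z ≠ a → h (f a) := by
      intro a z h1 h2 hne
      have h3 := classes a z h1 h2
      rcases h3.1 with h4 | h4 | h4
      · exact absurd h4.symm hne
      · exact absurd (layerRel_symm_eq h3.1 h3.2) h4.ne
      · exact h4.2
    have : layerRel f h = s := by
      funext a b
      refine propext ⟨hs.le a b, fun hab => ?_⟩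
      by_cases hba : s b a
      · exact (classes a b hab hba).1
      have hle : f a ≤ f b := by
        by_contra hlt
        exact hba (hs.le _ _ (Or.inr (Or.inl (not_le.1 hlt))))
      rcases hle.lt_or_eq with hlt | heq
      · exact Or.inr (Or.inl hlt)
      -- At equal ranks, a nontrivial class makes the rank homogeneous, hence relates `a` and `b`;
      -- two trivial classes are handled by `comp`.
      by_cases h1 : ∀ z, s a z → s z a → z = a
      · by_cases h2 : ∀ z, s b z → s z b → z = b
        · exact hs.comp a b hab h1 h2
        · push Not at h2
          obtain ⟨z, h3, h4, h5⟩ := h2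
          exact Or.inr (Or.inr ⟨heq, heq ▸ homog h3 h4 h5⟩)
      · push Not at h1
        obtain ⟨z, h3, h4, h5⟩ := h1
        exact Or.inr (Or.inr ⟨heq, homog h3 h4 h5⟩)
    rw [this]
    exact Relation.ReflTransGen.refl

/-! ### Partial sums -/

theorem segSum_zero_succ {N : ℕ} (f : Fin N → ℕ) (k : ℕ) :
    segSum f 0 (k + 1) = segSum f 0 k + if h : k < N then f ⟨k, h⟩ else 0 := by
  unfold segSum
  simp only [Nat.zero_le, true_and]
  split_ifs with h
  · have : (Finset.univ.filter fun t : Fin N => t.val < k + 1) =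
        insert ⟨k, h⟩ (Finset.univ.filter fun t : Fin N => t.val < k) := by
      ext t
      simp only [Finset.mem_filter, Finset.mem_univ, true_and, Finset.mem_insert, Fin.ext_iff]
      omega
    rw [this, Finset.sum_insert (by simp), add_comm]
  · have : (Finset.univ.filter fun t : Fin N => t.val < k + 1) =
        Finset.univ.filter fun t : Fin N => t.val < k := by
      ext t
      simp only [Finset.mem_filter, Finset.mem_univ, true_and]
      omega
    rw [this, add_zero]

theorem segSum_zero_zero {N : ℕ} (f : Fin N → ℕ) : segSum f 0 0 = 0 := by
  simp [segSum]

theorem segSum_eq_take_sum {N : ℕ} (f : Fin N → ℕ) (k : ℕ) :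
    segSum f 0 k = ((List.ofFn f).take k).sum := by
  induction k with
  | zero => simp [segSum_zero_zero]
  | succ k ih =>
    rw [segSum_zero_succ, ih, List.take_add_one, List.sum_append]
    congr 1
    split_ifs with h
    · simp [h]
    · simp [h]

theorem segSum_mono {N : ℕ} (f : Fin N → ℕ) : Monotone (segSum f 0) :=
  monotone_nat_of_le_succ fun k => by rw [segSum_zero_succ]; omega

theorem segSum_of_le {N k : ℕ} (f : Fin N → ℕ) (hk : N ≤ k) : segSum f 0 k = ∑ t, f t := by
  unfold segSum
  congr 1
  ext t
  simp only [Finset.mem_filter, Finset.mem_univ, true_and, iff_true]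
  omega

theorem segSum_zero_eq_add {N g : ℕ} (f : Fin (N + 1) → ℕ) (hg : 1 ≤ g) :
    segSum f 0 g = f 0 + segSum f 1 g := by
  unfold segSum
  have : (Finset.univ.filter fun t : Fin (N + 1) => 0 ≤ t.val ∧ t.val < g) =
      insert 0 (Finset.univ.filter fun t : Fin (N + 1) => 1 ≤ t.val ∧ t.val < g) := by
    ext t
    simp only [Finset.mem_filter, Finset.mem_univ, true_and, Finset.mem_insert, Fin.ext_iff,
      Fin.val_zero]
    omega
  rw [this, Finset.sum_insert (by simp)]

/-! ### Multiplicity vectors -/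

/-- The values 0, d_1, …, d_ℓ are distinct and exhaust the entries of `u`, so their fibres partition
the n positions. -/
theorem IsMultiplicityVector.sum_eq {n ℓ : ℕ} {m : Fin (ℓ + 1) → ℕ}
    (hm : IsMultiplicityVector n m) : ∑ t, m t = n := by
  obtain ⟨u, d, -, hu, -, hd, hr, h0, hi⟩ := hm
  have hpos : ∀ i, 0 < d i := fun i => ((hr (d i)).1 ⟨i, rfl⟩).1
  let v : Fin (ℓ + 1) → ℝ := Fin.cons 0 d
  have hv : Function.Injective v := by
    refine Fin.cons_injective_iff.2 ⟨?_, hd.injective⟩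
    rintro ⟨i, h⟩
    exact (hpos i).ne' h
  have hex : ∀ j, ∃ t, v t = u j := by
    intro j
    rcases (hu j).eq_or_lt with h | h
    · exact ⟨0, h⟩
    · obtain ⟨i, h'⟩ := (hr (u j)).2 ⟨h, j, rfl⟩
      exact ⟨i.succ, h'⟩
  choose c hc using hex
  have hcard : ∀ t, m t = (Finset.univ.filter fun j => c j = t).card := by
    have key : ∀ t, (Finset.univ.filter fun j => c j = t).card = Nat.card {j // u j = v t} := by
      intro t
      rw [Nat.card_eq_fintype_card, Fintype.card_subtype]
      congr 1
      ext j
      simp only [Finset.mem_filter, Finset.mem_univ, true_and]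
      exact ⟨fun h => by rw [← hc, h], fun h => hv ((hc j).trans h)⟩
    intro t
    rw [key]
    refine Fin.cases ?_ (fun i => ?_) t
    · exact h0
    · exact hi i
  calc ∑ t, m t = ∑ t, (Finset.univ.filter fun j => c j = t).card :=
        Finset.sum_congr rfl fun t _ => hcard t
    _ = (Finset.univ : Finset (Fin n)).card :=
        (Finset.card_eq_sum_card_fiberwise fun j _ => Finset.mem_coe.2 (Finset.mem_univ (c j))).symm
    _ = n := by simp

theorem IsMultiplicityVector.pos {n ℓ : ℕ} {m : Fin (ℓ + 1) → ℕ}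
    (hm : IsMultiplicityVector n m) (i : Fin ℓ) : 0 < m i.succ := by
  obtain ⟨u, d, -, -, -, -, hr, -, hi⟩ := hm
  obtain ⟨j, hj⟩ := ((hr (d i)).1 ⟨i, rfl⟩).2
  rw [hi]
  have : Nonempty {j // u j = d i} := ⟨⟨j, hj⟩⟩
  exact Nat.card_pos

theorem IsMultiplicityVector.one_le {n ℓ : ℕ} {m : Fin (ℓ + 1) → ℕ}
    (hm : IsMultiplicityVector n m) : 1 ≤ ℓ := by
  obtain ⟨u, d, -, hu, hne, -, hr, -, -⟩ := hm
  obtain ⟨j, hj⟩ := Function.ne_iff.1 hne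
  obtain ⟨i, -⟩ := (hr (u j)).2 ⟨lt_of_le_of_ne (hu j) (Ne.symm hj), j, rfl⟩
  have := i.isLt
  omega

theorem segSum_one {ℓ : ℕ} (m : Fin (ℓ + 1) → ℕ) : segSum m 0 1 = m 0 := by
  rw [segSum_zero_succ, segSum_zero_zero]
  simp

theorem IsMultiplicityVector.segSum_le {n ℓ : ℕ} {m : Fin (ℓ + 1) → ℕ}
    (hm : IsMultiplicityVector n m) (k : ℕ) : segSum m 0 k ≤ n := by
  rw [← hm.sum_eq, ← segSum_of_le m (le_max_left (ℓ + 1) k)]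
  exact segSum_mono m (le_max_right _ _)

theorem IsMultiplicityVector.segSum_eq {n ℓ k : ℕ} {m : Fin (ℓ + 1) → ℕ}
    (hm : IsMultiplicityVector n m) (hk : ℓ + 1 ≤ k) : segSum m 0 k = n := by
  rw [segSum_of_le m hk, hm.sum_eq]

theorem IsMultiplicityVector.segSum_lt {n ℓ i : ℕ} {m : Fin (ℓ + 1) → ℕ}
    (hm : IsMultiplicityVector n m) (hi : 1 ≤ i) (hi' : i ≤ ℓ) :
    segSum m 0 i < segSum m 0 (i + 1) := by
  rw [segSum_zero_succ, dif_pos (by omega)]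
  have := hm.pos ⟨i - 1, by omega⟩
  have h2 : (⟨i - 1, by omega⟩ : Fin ℓ).succ = ⟨i, by omega⟩ := by
    ext
    simp only [Fin.succ_mk]
    omega
  rw [h2] at this
  omega

theorem IsMultiplicityVector.zero_lt {n ℓ : ℕ} {m : Fin (ℓ + 1) → ℕ}
    (hm : IsMultiplicityVector n m) : m 0 < n := by
  have h1 := hm.segSum_lt (i := 1) le_rfl hm.one_le
  have h2 := hm.segSum_le 2
  rw [segSum_one] at h1
  exact lt_of_lt_of_le h1 h2

/-! ### Block indices -/

namespace SkewedBinaryPartition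

variable {n : ℕ} (B : SkewedBinaryPartition n)

/-- The position of the block containing `x`. -/
noncomputable def idx (x : Fin (n + 1)) : ℕ := (B.cover x).choose.val

/-- The block at position `k` is homogeneous. -/
def HomogAt (k : ℕ) : Prop := ∃ i : Fin (B.p + 2), i.val = k ∧ B.homog i = true

/-- The number of elements in the blocks at the positions before `k`. -/
noncomputable def countBelow (k : ℕ) : ℕ := (Finset.univ.filter fun z => B.idx z < k).card

theorem idx_lt (x : Fin (n + 1)) : B.idx x < B.p + 2 := (B.cover x).choose.isLt

theorem mem_block_iff {x : Fin (n + 1)} {i : Fin (B.p + 2)} : x ∈ B.block i ↔ B.idx x = i.val := by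
  have hx := (B.cover x).choose_spec
  constructor
  · intro h
    by_contra hne
    exact Finset.disjoint_left.1 (B.disjoint _ i fun h => hne (congrArg Fin.val h)) hx h
  · intro h
    have : (B.cover x).choose = i := Fin.ext h
    rwa [this] at hx

theorem block_eq (i : Fin (B.p + 2)) : B.block i = Finset.univ.filter fun z => B.idx z = i.val := by
  ext z
  simp [mem_block_iff]

theorem rel_iff {x y : Fin (n + 1)} :
    B.rel x y ↔ x = y ∨ B.idx x < B.idx y ∨ (B.idx x = B.idx y ∧ B.HomogAt (B.idx x)) := by
  unfold rel HomogAt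
  simp only [mem_block_iff]
  refine or_congr Iff.rfl (or_congr ?_ ?_)
  · constructor
    · rintro ⟨i, j, hij, h1, h2⟩
      rw [h1, h2]
      exact hij
    · intro h
      exact ⟨⟨_, B.idx_lt x⟩, ⟨_, B.idx_lt y⟩, h, rfl, rfl⟩
  · constructor
    · rintro ⟨i, h, h1, h2⟩
      exact ⟨h1.trans h2.symm, i, h1.symm, h⟩
    · rintro ⟨h1, i, h2, h⟩
      exact ⟨i, h, h2.symm, by omega⟩

theorem rel_eq_layerRel :
    B.rel = layerRel (fun x => (B.idx x : ℚ)) (fun c => ∃ k : ℕ, (k : ℚ) = c ∧ B.HomogAt k) := by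
  funext x y
  apply propext
  rw [rel_iff]
  unfold layerRel
  simp only [Nat.cast_lt, Nat.cast_inj, exists_eq_left]

theorem rel_trans (a b c : Fin (n + 1)) (h1 : B.rel a b) (h2 : B.rel b c) : B.rel a c := by
  rw [rel_eq_layerRel] at *
  exact layerRel_trans h1 h2

theorem idx_zero_le : B.idx 0 ≤ 1 := by
  rcases B.zero_mem with h | h
  · rw [mem_block_iff] at h
    simp [h]
  · rw [mem_block_iff] at h
    simp [h]

theorem not_homogAt_zero : ¬ B.HomogAt 0 := by
  rintro ⟨i, h1, h2⟩
  have : i = 0 := Fin.ext h1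
  rw [this, B.first_nonhomog] at h2
  exact Bool.noConfusion h2

theorem zero_mem_block_one : 0 ∈ B.block 1 ↔ B.idx 0 = 1 := by
  rw [mem_block_iff]
  simp

theorem idx_ne_one (h : B.idx 0 = 0) (z : Fin (n + 1)) : B.idx z ≠ 1 := by
  have h0 : (0 : Fin (n + 1)) ∈ B.block 0 := by
    rw [mem_block_iff]
    simpa using h
  have h1 := (B.zero_mem_first h0).2
  intro hz
  have : z ∈ B.block 1 := by
    rw [mem_block_iff]
    simpa using hz
  rw [h1] at this
  simp at this

theorem homogAt_of_ne {x y : Fin (n + 1)} (hx : B.idx x = 1) (hy : B.idx y = 1) (hne : x ≠ y) :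
    B.HomogAt 1 := by
  refine ⟨1, by simp, B.second_homog ?_⟩
  exact Finset.one_lt_card.2 ⟨x, by rw [mem_block_iff]; simpa using hx, y,
    by rw [mem_block_iff]; simpa using hy, hne⟩

theorem exists_ne_of_homogAt {x : Fin (n + 1)} (h : B.HomogAt (B.idx x)) :
    ∃ y, y ≠ x ∧ B.idx y = B.idx x := by
  obtain ⟨i, h1, h2⟩ := h
  have : 1 < (B.block i).card := by
    by_contra hle
    rw [B.small_nonhomog i (not_lt.1 hle)] at h2
    exact Bool.noConfusion h2
  obtain ⟨y, hy, hne⟩ := Finset.exists_mem_ne this x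
  rw [mem_block_iff, h1] at hy
  exact ⟨y, hne, hy⟩

theorem exists_idx_eq {k : ℕ} (hk : 2 ≤ k) (hk' : k < B.p + 2) : ∃ x, B.idx x = k := by
  obtain ⟨x, hx⟩ := B.nonempty ⟨k, hk'⟩ hk
  rw [mem_block_iff] at hx
  exact ⟨x, hx⟩

/-- Homogeneous blocks have at least two elements, so triviality of a class, as used in
`Refines.comp`, can be read off the flag. -/
theorem trivial_class_iff {x : Fin (n + 1)} :
    (∀ z, B.rel x z → B.rel z x → z = x) ↔ ¬ B.HomogAt (B.idx x) := by
  constructor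
  · intro h hh
    obtain ⟨y, hne, hy⟩ := B.exists_ne_of_homogAt hh
    exact hne (h y (B.rel_iff.2 (Or.inr (Or.inr ⟨hy.symm, hh⟩)))
      (B.rel_iff.2 (Or.inr (Or.inr ⟨hy, hy ▸ hh⟩))))
  · intro h z h1 h2
    rw [rel_iff] at h1 h2
    rcases h1 with h1 | h1 | h1
    · exact h1.symm
    · rcases h2 with h2 | h2 | h2
      · exact h2
      · omega
      · omega
    · exact absurd h1.2 h

theorem idx_le_of_rel {x y : Fin (n + 1)} (h : B.rel x y) : B.idx x ≤ B.idx y := by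
  rcases B.rel_iff.1 h with rfl | h | h
  · exact le_rfl
  · exact h.le
  · exact h.1.le

/-! ### The type in terms of block indices -/

theorem type_zero : B.type 0 = .plain ((B.block 0).card - if B.idx 0 = 0 then 1 else 0) := by
  have := B.idx_zero_le
  unfold type
  simp only [if_true, zero_mem_block_one]
  split_ifs <;> first | rfl | omega

theorem type_one : B.type 1 = if B.idx 0 = 1 then .circ ((B.block 1).card - 1)
    else .plain (B.block 1).card := by
  unfold type
  simp [zero_mem_block_one]

theorem type_of_two_le {i : Fin (B.p + 2)} (hi : 2 ≤ i.val) :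
    B.type i = if B.homog i = true then .star (B.block i).card else .plain (B.block i).card := by
  unfold type
  have h0 : i ≠ 0 := by rintro rfl; simp at hi
  have h1 : i ≠ 1 := by rintro rfl; simp at hi
  rw [if_neg h0, if_neg h1]

/-- The type omits the element 0 in whichever block contains it. -/
theorem card_block (i : Fin (B.p + 2)) :
    (B.block i).card = (B.type i).abs + if B.idx 0 = i.val then 1 else 0 := by
  have h01 := B.idx_zero_le
  have hpos : B.idx 0 = i.val → 1 ≤ (B.block i).card := fun h =>
    Finset.card_pos.2 ⟨0, B.mem_block_iff.2 h⟩
  by_cases h0 : i = 0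
  · subst h0
    rw [type_zero]
    by_cases h : B.idx 0 = 0
    · have := hpos h
      simp only [h, Entry.abs, Fin.val_zero, if_true]
      omega
    · simp [h, Entry.abs]
  by_cases h1 : i = 1
  · subst h1
    rw [type_one]
    by_cases h : B.idx 0 = 1
    · have := hpos (by simpa using h)
      simp only [h, Entry.abs, Fin.val_one, if_true]
      omega
    · simp [h, Entry.abs]
  · have hi : 2 ≤ i.val := by
      have h0' : i.val ≠ 0 := fun h => h0 (Fin.ext h)
      have h1' : i.val ≠ 1 := fun h => h1 (Fin.ext (by simpa using h))
      omega
    rw [B.type_of_two_le hi, if_neg (c := B.idx 0 = i.val) (by omega)]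
    split_ifs <;> simp [Entry.abs]

/-- The summand 1 is the element 0, which lies in one of the first two blocks; hence the bound on
`k`. -/
theorem countBelow_eq {k : ℕ} (hk : 2 ≤ k) :
    B.countBelow k = segSum (fun t => (B.type t).abs) 0 k + 1 := by
  have h1 : B.countBelow k = ∑ t : Fin (B.p + 2) with t.val < k, (B.block t).card := by
    unfold countBelow
    rw [Finset.card_eq_sum_card_fiberwise (f := fun z => (⟨B.idx z, B.idx_lt z⟩ : Fin (B.p + 2)))
      (t := Finset.univ.filter fun t : Fin (B.p + 2) => t.val < k) (by intro z hz; simpa using hz)]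
    refine Finset.sum_congr rfl fun t ht => ?_
    rw [block_eq]
    congr 1
    ext z
    simp only [Finset.mem_filter, Finset.mem_univ, true_and, Fin.ext_iff] at ht ⊢
    omega
  rw [h1, Finset.sum_congr rfl fun t _ => B.card_block t, Finset.sum_add_distrib]
  unfold segSum
  simp only [Nat.zero_le, true_and]
  congr 1
  rw [Finset.sum_eq_single (⟨B.idx 0, B.idx_lt 0⟩ : Fin (B.p + 2))]
  · simp
  · intro t _ ht
    rw [if_neg]
    intro h
    exact ht (Fin.ext h.symm)
  · intro h
    have := B.idx_zero_le
    simp only [Finset.mem_filter, Finset.mem_univ, true_and] at h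
    omega

theorem countBelow_two : B.countBelow 2 = (B.type 0).abs + (B.type 1).abs + 1 := by
  rw [B.countBelow_eq le_rfl, segSum_zero_succ, segSum_zero_succ, segSum_zero_zero]
  simp

theorem countBelow_mono : Monotone B.countBelow := by
  intro a b hab
  exact Finset.card_le_card fun z hz => by
    simp only [Finset.mem_filter, Finset.mem_univ, true_and] at hz ⊢
    omega

theorem type_one_eq_plain_zero_iff : B.type 1 = .plain 0 ↔ B.idx 0 = 0 := by
  have h01 := B.idx_zero_le
  rw [type_one]
  split_ifs with h
  · simp [h]
  · have h0 : B.idx 0 = 0 := by omega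
    simp only [h0, iff_true, Entry.plain.injEq, Finset.card_eq_zero]
    rw [block_eq]
    ext z
    simpa using B.idx_ne_one h0 z

theorem isPos_iff (j : Fin B.p) : (B.type j.succ.succ).IsPos ↔ ¬ B.HomogAt (j + 2) := by
  have hcard : 0 < (B.block j.succ.succ).card := Finset.card_pos.2 (B.nonempty _ (by simp))
  rw [B.type_of_two_le (by simp)]
  constructor
  · rintro ⟨c, hc, h⟩ ⟨i, hi, hh⟩
    have : i = j.succ.succ := Fin.ext hi
    rw [← this, if_pos hh] at h
    cases h
  · intro h
    rw [if_neg fun hh => h ⟨_, rfl, hh⟩]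
    exact ⟨_, hcard, rfl⟩

theorem isPosStar_iff (j : Fin B.p) : (B.type j.succ.succ).IsPosStar ↔ B.HomogAt (j + 2) := by
  have hcard : 0 < (B.block j.succ.succ).card := Finset.card_pos.2 (B.nonempty _ (by simp))
  rw [B.type_of_two_le (by simp)]
  constructor
  · rintro ⟨c, hc, h⟩
    by_cases hh : B.homog j.succ.succ = true
    · exact ⟨_, rfl, hh⟩
    · rw [if_neg hh] at h
      cases h
  · rintro ⟨i, hi, hh⟩
    have : i = j.succ.succ := Fin.ext hi
    rw [← this, if_pos hh, this]
    exact ⟨_, hcard, rfl⟩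

/-- The type of a skewed binary partition is a skewed binary composition. -/
theorem isSkewedBinaryComposition_type : IsSkewedBinaryComposition n B.type := by
  have h01 := B.idx_zero_le
  refine ⟨?_, ?_, ?_⟩
  · have h1 := B.countBelow_eq (k := B.p + 2) (by omega)
    rw [segSum_of_le _ le_rfl] at h1
    have h2 : B.countBelow (B.p + 2) = n + 1 := by
      unfold countBelow
      rw [Finset.filter_true_of_mem fun z _ => B.idx_lt z]
      simp
    omega
  · by_cases h : B.idx 0 = 1
    · left
      exact ⟨_, _, B.type_zero, by rw [type_one, if_pos h]⟩
    · right
      have h0 : B.idx 0 = 0 := by omega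
      have hm : (0 : Fin (n + 1)) ∈ B.block 0 := B.mem_block_iff.2 (by simpa using h0)
      have := (B.zero_mem_first hm).1
      refine ⟨_, ?_, B.type_zero, B.type_one_eq_plain_zero_iff.2 h0⟩
      rw [if_pos h0]
      omega
  · intro i hi
    rw [B.type_of_two_le hi]
    split_ifs with hh
    · right
      refine ⟨_, ?_, rfl⟩
      by_contra hlt
      rw [B.small_nonhomog i (by omega)] at hh
      exact Bool.noConfusion hh
    · left
      exact ⟨_, Finset.card_pos.2 (B.nonempty i hi), rfl⟩

/-- Counting 0 shifts all partial sums of the type by one, which turns the first weak inequality of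
(*) into a strict one. -/
theorem fits_iff {ℓ : ℕ} (m : Fin (ℓ + 1) → ℕ) (i j : ℕ) :
    Fits m B.type i j ↔ (1 ≤ i ∧ i ≤ ℓ) ∧ (1 ≤ j ∧ j ≤ B.p) ∧
      segSum m 0 i < B.countBelow (j + 1) ∧ B.countBelow (j + 1) < B.countBelow (j + 2) ∧
      B.countBelow (j + 2) ≤ segSum m 0 (i + 1) + 1 := by
  unfold Fits
  refine and_congr_right fun _ => and_congr_right fun hj => ?_
  rw [B.countBelow_eq (k := j + 1) (by omega), B.countBelow_eq (k := j + 2) (by omega)]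
  omega

end SkewedBinaryPartition

/-! ### Level functions -/

/-- The description of the partial orders of the skewed binary partitions with type in `Ω_m` by
level functions. If `0` shares its level with all elements below level `2`, the partial order comes
from `a_0`, otherwise from some `a_i` with `i ≥ 1` and `K = m_0 + i`. -/
structure IsLevel {n ℓ : ℕ} (m : Fin (ℓ + 1) → ℕ) (K : ℕ) (lam : Fin (n + 1) → ℕ) : Prop where
  count : ∀ i, (Finset.univ.filter fun z => lam z ≤ i + 1).card = max (segSum m 0 (i + 1)) K + 1
  kind : (K = m 0 ∧ lam 0 = 1 ∧ ∀ z, 1 ≤ lam z) ∨ (m 0 < K ∧ K ≤ n ∧ ∀ z, lam z = 1 ↔ z = 0)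

/-! ### Reading blocks off a type in Ω_m -/

theorem ofFn_eq_cons_cons {N : ℕ} (f : Fin (N + 2) → Entry) :
    List.ofFn f = f 0 :: f 1 :: List.ofFn fun j : Fin N => f j.succ.succ := by
  rw [List.ofFn_succ, List.ofFn_succ]
  rfl

theorem type_eq_of_ofFn_eq {N : ℕ} {f : Fin (N + 2) → Entry} {a b : Entry} {L : List Entry}
    (h : List.ofFn f = a :: b :: L) : f 0 = a ∧ f 1 = b ∧ ∀ j : Fin N, f j.succ.succ ∈ L := by
  rw [ofFn_eq_cons_cons, List.cons.injEq, List.cons.injEq] at h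
  refine ⟨h.1, h.2.1, fun j => ?_⟩
  rw [← h.2.2]
  exact (List.mem_ofFn' _ _).2 ⟨j, rfl⟩

namespace SkewedBinaryPartition

variable {n : ℕ} (A : SkewedBinaryPartition n)

/-- Without stars only B_0 could be homogeneous, but |b_0| = 0 leaves it at most one element. -/
theorem not_homogAt_of_type {a : Entry} {b : Entry} {L : List ℕ}
    (h : List.ofFn A.type = a :: b :: L.map .plain) (hb : b.abs = 0) (k : ℕ) :
    ¬ A.HomogAt k := by
  obtain ⟨-, h1, h2⟩ := type_eq_of_ofFn_eq h
  rintro ⟨i, rfl, hi⟩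
  have hcard : 1 < (A.block i).card := by
    by_contra hle
    rw [A.small_nonhomog i (not_lt.1 hle)] at hi
    exact Bool.noConfusion hi
  by_cases i0 : i = 0
  · rw [i0, A.first_nonhomog] at hi
    exact Bool.noConfusion hi
  by_cases i1 : i = 1
  · rw [i1, A.card_block, h1, hb] at hcard
    split_ifs at hcard <;> omega
  · have i0' : i.val ≠ 0 := fun h => i0 (Fin.ext h)
    have i1' : i.val ≠ 1 := fun h => i1 (Fin.ext (by simpa using h))
    have h3 := h2 ⟨i.val - 2, by omega⟩
    have h4 : (⟨i.val - 2, by omega⟩ : Fin A.p).succ.succ = i := by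
      ext
      simp only [Fin.succ_mk]
      omega
    rw [h4, A.type_of_two_le (by omega), if_pos hi] at h3
    simp at h3

theorem countBelow_of_type {a b : Entry} {L : List ℕ}
    (h : List.ofFn A.type = a :: b :: L.map .plain) (k : ℕ) :
    A.countBelow (k + 2) = a.abs + b.abs + (L.take k).sum + 1 := by
  rw [A.countBelow_eq (by omega), segSum_eq_take_sum]
  have h1 : List.ofFn (fun t => (A.type t).abs) = (List.ofFn A.type).map Entry.abs := by
    rw [List.map_ofFn]
    rfl
  have h2 : (L.map Entry.plain).map Entry.abs = L := by
    rw [List.map_map]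
    exact (List.map_congr_left fun _ _ => rfl).trans (List.map_id L)
  rw [h1, h, List.map_cons, List.map_cons, h2]
  simp [add_assoc]

theorem idx_eq_one_iff (h : A.type 1 = .circ 0) (z : Fin (n + 1)) : A.idx z = 1 ↔ z = 0 := by
  have h0 : A.idx 0 = 1 := by
    by_contra h0
    rw [type_one, if_neg h0] at h
    cases h
  have hc := A.card_block 1
  rw [h] at hc
  simp only [Entry.abs, h0, Fin.val_one, if_true, zero_add] at hc
  obtain ⟨w, hw⟩ := Finset.card_eq_one.1 hc
  have mem : ∀ x, A.idx x = 1 ↔ x = w := by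
    intro x
    have h2 := A.mem_block_iff (x := x) (i := 1)
    rw [hw] at h2
    simpa using h2.symm
  rw [mem, (mem 0).1 h0]

end SkewedBinaryPartition

theorem cons_drop_ofFn {ℓ : ℕ} (m : Fin (ℓ + 1) → ℕ) :
    m 0 :: (List.ofFn m).drop 1 = List.ofFn m := by
  rw [List.ofFn_succ, List.drop_one, List.tail_cons]

/-- A skewed binary partition with type in `Ω_m` has a level function. -/
theorem exists_isLevel {n ℓ : ℕ} {m : Fin (ℓ + 1) → ℕ} (hm : IsMultiplicityVector n m)
    {A : SkewedBinaryPartition n} (hA : List.ofFn A.type ∈ Omega m) :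
    ∃ K lam, IsLevel m K lam ∧ ∀ x y, A.rel x y ↔ x = y ∨ lam x < lam y := by
  have hmn := hm.zero_lt
  have h01 := A.idx_zero_le
  have hrel : (∀ k, ¬ A.HomogAt k) → ∀ lam : Fin (n + 1) → ℕ,
      (∀ x y, A.idx x < A.idx y ↔ lam x < lam y) →
      ∀ x y, A.rel x y ↔ x = y ∨ lam x < lam y := by
    intro hno lam hlam x y
    rw [A.rel_iff, hlam]
    simp [hno]
  have takeM : ∀ i, m 0 + (((List.ofFn m).drop 1).take i).sum = segSum m 0 (i + 1) := by
    intro i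
    rw [segSum_eq_take_sum]
    conv_rhs => rw [← cons_drop_ofFn m]
    rw [List.take_succ_cons, List.sum_cons]
  rcases hA with ⟨h0, hA⟩ | ⟨h0, hA⟩ | ⟨k, g, hk, hg, hgl, hk1, hk2, hA⟩ | hA
  · have hno := A.not_homogAt_of_type hA rfl
    have hi0 : A.idx 0 = 0 := A.type_one_eq_plain_zero_iff.1 (type_eq_of_ofFn_eq hA).2.1
    have hne := A.idx_ne_one hi0
    -- Here 0 lies in B_{-1} and B_0 is empty, so position 0 can be raised to level 1 without
    -- changing the order.
    refine ⟨m 0, fun z => max 1 (A.idx z), ⟨fun i => ?_, Or.inl ⟨rfl, by simp [hi0], by simp⟩⟩,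
      hrel hno _ fun x y => ?_⟩
    · have h1 := A.countBelow_of_type hA i
      simp only [Entry.abs, add_zero, takeM] at h1
      rw [max_eq_left (by rw [← segSum_one m]; exact segSum_mono m (by omega)), ← h1]
      unfold SkewedBinaryPartition.countBelow
      congr 1
      ext z
      simp only [Finset.mem_filter, Finset.mem_univ, true_and]
      omega
    · have := hne x
      have := hne y
      omega
  · have hno := A.not_homogAt_of_type hA rfl
    obtain ⟨ht0, ht1, -⟩ := type_eq_of_ofFn_eq hA
    have hi0 : A.idx 0 = 1 := (A.idx_eq_one_iff ht1 0).2 rfl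
    have hne : ∀ z, A.idx z ≠ 0 := by
      intro z hz
      have hc := A.card_block 0
      rw [ht0] at hc
      simp only [Entry.abs, hi0, Fin.val_zero, one_ne_zero, if_false, add_zero,
        Finset.card_eq_zero] at hc
      have : z ∈ A.block 0 := A.mem_block_iff.2 (by simpa using hz)
      rw [hc] at this
      simp at this
    refine ⟨m 0, A.idx, ⟨fun i => ?_, Or.inl ⟨rfl, hi0, fun z => ?_⟩⟩, hrel hno _ fun x y => Iff.rfl⟩
    · have h1 := A.countBelow_of_type hA i
      simp only [Entry.abs, add_zero] at h1
      have h2 := takeM i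
      rw [h0] at h2
      rw [h2] at h1
      rw [max_eq_left (by rw [← segSum_one m]; exact segSum_mono m (by omega)), ← h1]
      unfold SkewedBinaryPartition.countBelow
      congr 1
      ext z
      simp only [Finset.mem_filter, Finset.mem_univ, true_and]
      omega
    · have := hne z
      omega
  · have hA' : List.ofFn A.type = .plain (m 0 + k) :: .circ 0 ::
        ((segSum m 1 (g + 1) - k) :: (List.ofFn m).drop (g + 1)).map .plain := by
      rw [hA, List.map_cons]
    have hno := A.not_homogAt_of_type hA' rfl
    obtain ⟨ht0, ht1, -⟩ := type_eq_of_ofFn_eq hA'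
    have hi1 := A.idx_eq_one_iff ht1
    have hs1 := segSum_zero_eq_add m hg
    have hs2 := segSum_zero_eq_add m (g := g + 1) (by omega)
    have hle := hm.segSum_le (g + 1)
    -- B_{-1} absorbs m_1, …, m_{g-1} and possibly part of m_g, so levels 2, …, g are empty and B_1
    -- receives level g + 1.
    refine ⟨m 0 + k, fun z => if A.idx z ≤ 1 then A.idx z else A.idx z + (g - 1),
      ⟨fun i => ?_, Or.inr ⟨by omega, by omega, fun z => ?_⟩⟩, hrel hno _ fun x y => ?_⟩
    · by_cases hi : i < g
      · have h1 := A.countBelow_of_type hA' 0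
        simp only [Entry.abs, add_zero, List.take_zero, List.sum_nil] at h1
        have h2 : segSum m 0 (i + 1) ≤ segSum m 0 g := segSum_mono m (by omega)
        rw [max_eq_right (by omega), ← h1]
        unfold SkewedBinaryPartition.countBelow
        congr 1
        ext z
        simp only [Finset.mem_filter, Finset.mem_univ, true_and]
        split_ifs <;> omega
      · have h1 := A.countBelow_of_type hA' (i - g + 1)
        have h2 : segSum m 0 (i + 1) =
            segSum m 0 (g + 1) + (((List.ofFn m).drop (g + 1)).take (i - g)).sum := by
          rw [segSum_eq_take_sum, segSum_eq_take_sum, show i + 1 = (g + 1) + (i - g) by omega,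
            List.take_add, List.sum_append]
        simp only [Entry.abs, add_zero, List.take_succ_cons, List.sum_cons] at h1
        rw [max_eq_left (by omega), show segSum m 0 (i + 1) + 1 = A.countBelow (i - g + 1 + 2) by
          rw [h1, h2]; omega]
        unfold SkewedBinaryPartition.countBelow
        congr 1
        ext z
        simp only [Finset.mem_filter, Finset.mem_univ, true_and]
        split_ifs <;> omega
    · rw [← hi1 z]
      split_ifs <;> omega
    · split_ifs <;> omega
  · have hA' : List.ofFn A.type = .plain (∑ t, m t) :: .circ 0 :: ([] : List ℕ).map .plain := hA
    have hno := A.not_homogAt_of_type hA' rfl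
    obtain ⟨ht0, ht1, -⟩ := type_eq_of_ofFn_eq hA'
    have hi1 := A.idx_eq_one_iff ht1
    -- With K = n all multiplicities are absorbed and only levels 0 and 1 occur.
    refine ⟨n, A.idx, ⟨fun i => ?_, Or.inr ⟨hmn, le_rfl, hi1⟩⟩, hrel hno _ fun x y => Iff.rfl⟩
    have h1 := A.countBelow_of_type hA' i
    simp only [Entry.abs, add_zero, List.take_nil, List.sum_nil, hm.sum_eq] at h1
    rw [max_eq_right (hm.segSum_le _)]
    refine Eq.trans ?_ h1
    unfold SkewedBinaryPartition.countBelow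
    congr 1
    ext z
    simp only [Finset.mem_filter, Finset.mem_univ, true_and]
    omega

/-- The skewed binary partition without homogeneous blocks given by a block index function. -/
def ofIdx {n : ℕ} (p : ℕ) (f : Fin (n + 1) → ℕ) (hf : ∀ z, f z < p + 2)
    (hsurj : ∀ k, 2 ≤ k → k < p + 2 → ∃ z, f z = k) (h0 : f 0 ≤ 1)
    (h00 : f 0 = 0 → (∃ z, z ≠ 0 ∧ f z = 0) ∧ ∀ z, f z ≠ 1)
    (h1 : ∀ z, f z = 1 → z = 0) : SkewedBinaryPartition n where
  p := p
  block i := Finset.univ.filter fun z => f z = i.val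
  homog _ := false
  disjoint i j hij := by
    rw [Finset.disjoint_left]
    intro z hz hz'
    simp only [Finset.mem_filter, Finset.mem_univ, true_and] at hz hz'
    exact hij (Fin.ext (hz.symm.trans hz'))
  cover z := ⟨⟨f z, hf z⟩, by simp⟩
  first_nonhomog := rfl
  second_homog h := by
    exfalso
    obtain ⟨x, hx, y, hy, hne⟩ := Finset.one_lt_card.1 h
    simp only [Finset.mem_filter, Finset.mem_univ, true_and] at hx hy
    exact hne ((h1 x hx).trans (h1 y hy).symm)
  zero_mem := by
    simp only [Finset.mem_filter, Finset.mem_univ, true_and]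
    exact Nat.le_one_iff_eq_zero_or_eq_one.1 h0
  zero_mem_first h := by
    simp only [Finset.mem_filter, Finset.mem_univ, true_and] at h
    obtain ⟨⟨z, hz, hz'⟩, h2⟩ := h00 h
    refine ⟨Finset.one_lt_card.2 ⟨z, Finset.mem_filter.2 ⟨Finset.mem_univ _, hz'⟩, 0,
      Finset.mem_filter.2 ⟨Finset.mem_univ _, h⟩, hz⟩, ?_⟩
    exact Finset.filter_eq_empty_iff.2 fun z _ => h2 z
  small_nonhomog _ _ := rfl
  nonempty i hi := by
    obtain ⟨z, hz⟩ := hsurj i.val hi i.isLt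
    exact ⟨z, by simpa using hz⟩

/-! ### Preorder and type of a partition built from its block indices -/

section ofIdx

variable {n p : ℕ} {f : Fin (n + 1) → ℕ} {hf : ∀ z, f z < p + 2}
    {hsurj : ∀ k, 2 ≤ k → k < p + 2 → ∃ z, f z = k} {h0 : f 0 ≤ 1}
    {h00 : f 0 = 0 → (∃ z, z ≠ 0 ∧ f z = 0) ∧ ∀ z, f z ≠ 1}
    {h1 : ∀ z, f z = 1 → z = 0}

theorem ofIdx_rel (x y : Fin (n + 1)) :
    (ofIdx p f hf hsurj h0 h00 h1).rel x y ↔ x = y ∨ f x < f y := by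
  have hidx : ∀ z, (ofIdx p f hf hsurj h0 h00 h1).idx z = f z := fun z =>
    ((SkewedBinaryPartition.mem_block_iff _ (i := ⟨f z, hf z⟩)).1 (by simp [ofIdx]))
  rw [SkewedBinaryPartition.rel_iff, hidx, hidx]
  have : ∀ k, ¬ (ofIdx p f hf hsurj h0 h00 h1).HomogAt k := by
    rintro k ⟨i, -, hi⟩
    exact Bool.noConfusion hi
  simp [this]

theorem ofIdx_type_list : List.ofFn (ofIdx p f hf hsurj h0 h00 h1).type =
    .plain ((Finset.univ.filter fun z => f z = 0).card - if f 0 = 0 then 1 else 0) ::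
    (if f 0 = 1 then .circ ((Finset.univ.filter fun z => f z = 1).card - 1)
      else .plain (Finset.univ.filter fun z => f z = 1).card) ::
    (List.ofFn fun j : Fin p => (Finset.univ.filter fun z => f z = j.val + 2).card).map .plain := by
  have hidx : (ofIdx p f hf hsurj h0 h00 h1).idx 0 = f 0 :=
    ((SkewedBinaryPartition.mem_block_iff _ (i := ⟨f 0, hf 0⟩)).1 (by simp [ofIdx]))
  have e0 := (ofIdx p f hf hsurj h0 h00 h1).type_zero
  have e1 := (ofIdx p f hf hsurj h0 h00 h1).type_one
  rw [hidx] at e0 e1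
  rw [List.map_ofFn]
  refine (ofFn_eq_cons_cons (ofIdx p f hf hsurj h0 h00 h1).type).trans ?_
  refine congrArg₂ _ (e0.trans ?_) (congrArg₂ _ (e1.trans ?_) (congrArg _ (funext fun j => ?_)))
  · rfl
  · rfl
  · rw [SkewedBinaryPartition.type_of_two_le _ (by simp)]
    rfl

end ofIdx

theorem IsLevel.le_magnitude {n ℓ : ℕ} {m : Fin (ℓ + 1) → ℕ} (hm : IsMultiplicityVector n m)
    {K : ℕ} {lam : Fin (n + 1) → ℕ} (hl : IsLevel m K lam) : K ≤ n := by
  rcases hl.kind with h | h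
  · have := hm.zero_lt
    omega
  · exact h.2.1

/-- The levels up to ℓ + 1 already contain max(n, K) + 1 = n + 1 elements. -/
theorem IsLevel.le_last {n ℓ : ℕ} {m : Fin (ℓ + 1) → ℕ} (hm : IsMultiplicityVector n m)
    {K : ℕ} {lam : Fin (n + 1) → ℕ} (hl : IsLevel m K lam) (z : Fin (n + 1)) : lam z ≤ ℓ + 1 := by
  have h1 := hl.count ℓ
  rw [hm.segSum_eq le_rfl, max_eq_left (hl.le_magnitude hm)] at h1
  have h2 : (Finset.univ.filter fun z => lam z ≤ ℓ + 1) = Finset.univ :=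
    Finset.eq_univ_of_card _ (by simpa using h1)
  have : z ∈ Finset.univ.filter fun z => lam z ≤ ℓ + 1 := by rw [h2]; simp
  simpa using this

/-- A level function comes from a skewed binary partition with type in `Ω_m`. -/
theorem IsLevel.exists_partition {n ℓ : ℕ} {m : Fin (ℓ + 1) → ℕ} (hm : IsMultiplicityVector n m)
    {K : ℕ} {lam : Fin (n + 1) → ℕ} (hl : IsLevel m K lam) :
    ∃ A : SkewedBinaryPartition n, List.ofFn A.type ∈ Omega m ∧
      ∀ x y, A.rel x y ↔ x = y ∨ lam x < lam y := by
  have hKn := hl.le_magnitude hm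
  have hlast := hl.le_last hm
  have hlevel : ∀ i, (Finset.univ.filter fun z => lam z = i + 2).card =
      max (segSum m 0 (i + 2)) K - max (segSum m 0 (i + 1)) K := by
    intro i
    have h1 := hl.count i
    have h2 := hl.count (i + 1)
    have h3 : (Finset.univ.filter fun z => lam z ≤ i + 1 + 1) =
        (Finset.univ.filter fun z => lam z ≤ i + 1) ∪
          (Finset.univ.filter fun z => lam z = i + 2) := by
      ext z
      simp only [Finset.mem_filter, Finset.mem_univ, true_and, Finset.mem_union]
      omega
    rw [h3, Finset.card_union_of_disjoint, h1] at h2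
    · have : i + 1 + 1 = i + 2 := rfl
      rw [this] at h2
      omega
    · rw [Finset.disjoint_left]
      intro z hz hz'
      simp only [Finset.mem_filter, Finset.mem_univ, true_and] at hz hz'
      omega
  have hT0 : ∀ i, m 0 ≤ segSum m 0 (i + 1) := fun i => by
    rw [← segSum_one m]
    exact segSum_mono m (by omega)
  have hstep : ∀ i (hi : i < ℓ), segSum m 0 (i + 2) - segSum m 0 (i + 1) =
      m ⟨i + 1, by omega⟩ := by
    intro i hi
    rw [segSum_zero_succ m (i + 1), dif_pos (by omega)]
    omega
  have ex_of_card : ∀ k, 0 < (Finset.univ.filter fun z => lam z = k).card → ∃ z, lam z = k := by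
    intro k hk
    obtain ⟨z, hz⟩ := Finset.card_pos.1 hk
    exact ⟨z, by simpa using hz⟩
  rcases hl.kind with ⟨hK, hl0, hl1⟩ | ⟨hK, -, hl1⟩
  · have hlev : ∀ i (hi : i < ℓ), (Finset.univ.filter fun z => lam z = i + 2).card =
        m ⟨i + 1, by omega⟩ := by
      intro i hi
      have h1 := hT0 i
      have h2 := hT0 (i + 1)
      rw [hlevel, hK, max_eq_left h1, max_eq_left h2, hstep i hi]
    have hex : ∀ k, 2 ≤ k → k < ℓ + 2 → ∃ z, lam z = k := by
      intro k hk hk'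
      obtain ⟨i, rfl⟩ := Nat.exists_eq_add_of_le' hk
      apply ex_of_card
      rw [hlev i (by omega)]
      exact hm.pos ⟨i, by omega⟩
    have hfirst : (Finset.univ.filter fun z => lam z ≤ 1).card = m 0 + 1 := by
      have := hl.count 0
      rwa [segSum_one, hK, max_self] at this
    have htail : (List.ofFn fun j : Fin ℓ => (Finset.univ.filter fun z => lam z = j.val + 2).card) =
        (List.ofFn m).drop 1 := by
      rw [List.ofFn_succ, List.drop_one, List.tail_cons]
      exact congrArg _ (funext fun j => hlev j.val j.isLt)
    by_cases hm0 : 0 < m 0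
    -- For m_0 > 0 the lowest level, which contains 0, must become B_{-1}, with B_0 left empty.
    · let f : Fin (n + 1) → ℕ := fun z => if lam z = 1 then 0 else lam z
      have hf2 : ∀ k z, f z = k + 2 ↔ lam z = k + 2 := by
        intro k z
        by_cases h : lam z = 1
        · simp [f, h]
        · simp [f, h]
      have hf0 : ∀ z, f z = 0 ↔ lam z ≤ 1 := by
        intro z
        have := hl1 z
        simp only [f]
        split_ifs <;> omega
      have hf1 : ∀ z, f z ≠ 1 := by
        intro z
        have := hl1 z
        simp only [f]
        split_ifs <;> omega
      have hz : f 0 = 0 := by simp [f, hl0]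
      have hzc : (Finset.univ.filter fun z => f z = 0).card = m 0 + 1 := by
        rw [← hfirst]
        simp only [hf0]
      refine ⟨ofIdx ℓ f (fun z => ?_) (fun k hk hk' => ?_) (by omega) (fun _ => ⟨?_, hf1⟩)
        (fun z h => absurd h (hf1 z)), ?_, fun x y => ?_⟩
      · have := hlast z
        simp only [f]
        split_ifs <;> omega
      · obtain ⟨z, h⟩ := hex k hk hk'
        obtain ⟨i, rfl⟩ := Nat.exists_eq_add_of_le' hk
        exact ⟨z, (hf2 i z).2 h⟩
      · obtain ⟨z, h, h'⟩ := Finset.exists_mem_ne (s := Finset.univ.filter fun z => f z = 0)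
          (by rw [hzc]; omega) 0
        exact ⟨z, h', by simpa using h⟩
      · refine Or.inl ⟨hm0, ?_⟩
        rw [ofIdx_type_list, hzc]
        simp only [hf2, htail, hz, if_true, Nat.add_sub_cancel]
        simp [hf1]
      · rw [ofIdx_rel]
        have := hl1 x
        have := hl1 y
        simp only [f]
        refine or_congr Iff.rfl ?_
        split_ifs <;> omega
    · have hm0' : m 0 = 0 := by omega
      have h1 : ∀ z, lam z = 1 → z = 0 := by
        intro z hz
        rw [hm0'] at hfirst
        exact Finset.card_le_one.1 hfirst.le z (by simp [hz]) 0 (by simp [hl0])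
      refine ⟨ofIdx ℓ lam (fun z => ?_) hex (by omega) (fun h => by omega) h1, ?_,
        fun x y => ofIdx_rel x y⟩
      · have := hlast z
        omega
      · refine Or.inr (Or.inl ⟨hm0', ?_⟩)
        rw [ofIdx_type_list, htail, hl0]
        have e0 : (Finset.univ.filter fun z => lam z = 0) = ∅ := by
          ext z
          have := hl1 z
          simp only [Finset.mem_filter, Finset.mem_univ, true_and, Finset.notMem_empty, iff_false]
          omega
        have e1 : (Finset.univ.filter fun z => lam z = 1) = {0} := by
          ext z
          simp only [Finset.mem_filter, Finset.mem_univ, true_and, Finset.mem_singleton]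
          exact ⟨h1 z, fun h => h ▸ hl0⟩
        rw [e0, e1]
        simp
  · have hz : lam 0 = 1 := (hl1 0).2 rfl
    have hfirst : (Finset.univ.filter fun z => lam z ≤ 1).card = K + 1 := by
      have := hl.count 0
      rwa [segSum_one, max_eq_right hK.le] at this
    have e1 : (Finset.univ.filter fun z => lam z = 1) = {0} := by
      ext z
      simp [hl1]
    have e0 : (Finset.univ.filter fun z => lam z = 0).card = K := by
      have : (Finset.univ.filter fun z => lam z ≤ 1) =
          (Finset.univ.filter fun z => lam z = 0) ∪ {0} := by
        rw [← e1]
        ext z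
        simp only [Finset.mem_filter, Finset.mem_univ, true_and, Finset.mem_union]
        omega
      rw [this, Finset.card_union_of_disjoint (by simp [hz]), Finset.card_singleton] at hfirst
      omega
    by_cases hKn' : K = n
    · have hle : ∀ z, lam z ≤ 1 := by
        have h2 : (Finset.univ.filter fun z => lam z ≤ 1) = Finset.univ :=
          Finset.eq_univ_of_card _ (by simpa [hKn'] using hfirst)
        intro z
        have : z ∈ Finset.univ.filter fun z => lam z ≤ 1 := by rw [h2]; simp
        simpa using this
      refine ⟨ofIdx 0 lam (fun z => ?_) (fun k hk hk' => by omega) (by omega) (fun h => by omega)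
        (fun z => (hl1 z).1), ?_, fun x y => ofIdx_rel x y⟩
      · have := hle z
        omega
      · refine Or.inr (Or.inr (Or.inr ?_))
        rw [ofIdx_type_list, e0, e1, hz, hm.sum_eq, hKn']
        simp
    · have hex : ∃ g, K < segSum m 0 (g + 1) := ⟨ℓ, by rw [hm.segSum_eq le_rfl]; omega⟩
      -- This `g` is the index in the definition of a_{K - m_0}: the first for which m_0 + ⋯ + m_g
      -- exceeds K.
      obtain ⟨g, hg, hmin⟩ : ∃ g, K < segSum m 0 (g + 1) ∧ ∀ i < g, segSum m 0 (i + 1) ≤ K := by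
        classical
        exact ⟨Nat.find hex, Nat.find_spec hex, fun i hi => not_lt.1 (Nat.find_min hex hi)⟩
      have hg1 : 1 ≤ g := by
        by_contra h
        have : g = 0 := by omega
        rw [this, segSum_one] at hg
        omega
      have hgl : g ≤ ℓ := by
        by_contra h
        have := hmin ℓ (by omega)
        rw [hm.segSum_eq le_rfl] at this
        omega
      have hprev : segSum m 0 g ≤ K := by
        have := hmin (g - 1) (by omega)
        rwa [Nat.sub_add_cancel hg1] at this
      have hs1 := segSum_zero_eq_add m hg1
      have hs2 := segSum_zero_eq_add m (g := g + 1) (by omega)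
      -- Up to level g there are K + 1 elements, as many as up to level 1, so the levels between are
      -- empty and can be removed.
      have hgap : ∀ z, 2 ≤ lam z → g + 1 ≤ lam z := by
        intro z hz2
        have hc := hl.count (g - 1)
        rw [Nat.sub_add_cancel hg1, max_eq_right hprev, ← hfirst] at hc
        have hsub : (Finset.univ.filter fun z => lam z ≤ 1) ⊆
            (Finset.univ.filter fun z => lam z ≤ g) := by
          intro z hz
          simp only [Finset.mem_filter, Finset.mem_univ, true_and] at hz ⊢
          omega
        have he := Finset.eq_of_subset_of_card_le hsub hc.le
        by_contra hlt
        have hm' : z ∈ (Finset.univ.filter fun z => lam z ≤ g) := by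
          simp only [Finset.mem_filter, Finset.mem_univ, true_and]
          omega
        rw [← he] at hm'
        simp only [Finset.mem_filter, Finset.mem_univ, true_and] at hm'
        omega
      let f : Fin (n + 1) → ℕ := fun z => if lam z ≤ 1 then lam z else lam z - (g - 1)
      have hf2 : ∀ k z, f z = k + 2 ↔ lam z = (k + g - 1) + 2 := by
        intro k z
        have := hgap z
        simp only [f]
        split_ifs <;> omega
      have hf1 : ∀ z, f z = 1 ↔ lam z = 1 := by
        intro z
        have := hgap z
        simp only [f]
        split_ifs <;> omega
      have hf0 : ∀ z, f z = 0 ↔ lam z = 0 := by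
        intro z
        have := hgap z
        simp only [f]
        split_ifs <;> omega
      have hc2 : (Finset.univ.filter fun z => f z = 2).card = segSum m 0 (g + 1) - K := by
        have h2 := hf2 0
        have e1 : 0 + g - 1 + 2 = g - 1 + 2 := by omega
        have e2 : g - 1 + 2 = g + 1 := by omega
        have e3 : g - 1 + 1 = g := by omega
        simp only [zero_add] at h2
        simp only [h2]
        rw [hlevel, e2, e3, max_eq_left hg.le, max_eq_right hprev]
      have hc3 : ∀ k (hk : g + 1 + k < ℓ + 1), (Finset.univ.filter fun z => f z = k + 3).card =
          m ⟨g + 1 + k, hk⟩ := by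
        intro k hk
        have h2 := hf2 (k + 1)
        have e1 : k + 1 + g - 1 = k + g := by omega
        have e2 : k + 1 + 2 = k + 3 := by omega
        rw [e1, e2] at h2
        simp only [h2]
        have h3 : K ≤ segSum m 0 (k + g + 1) := hg.le.trans (segSum_mono m (by omega))
        have h4 : K ≤ segSum m 0 (k + g + 2) := hg.le.trans (segSum_mono m (by omega))
        rw [hlevel, max_eq_left h3, max_eq_left h4, hstep (k + g) (by omega)]
        congr 1
        ext
        simp only
        omega
      have hfz : f 0 = 1 := (hf1 0).2 hz
      have htail : (List.ofFn fun j : Fin (ℓ - g + 1) =>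
            (Finset.univ.filter fun z => f z = j.val + 2).card) =
          (segSum m 0 (g + 1) - K) :: (List.ofFn m).drop (g + 1) := by
        rw [List.ofFn_succ]
        refine congrArg₂ _ hc2 ?_
        apply List.ext_getElem
        · simp
        · intro k h1 h2
          simp only [List.getElem_ofFn, List.getElem_drop, Fin.val_succ]
          exact hc3 k _
      refine ⟨ofIdx (ℓ - g + 1) f (fun z => ?_) (fun k hk hk' => ?_) (by omega)
        (fun h => by omega) (fun z h => (hl1 z).1 ((hf1 z).1 h)), ?_, fun x y => ?_⟩
      · have := hlast z
        simp only [f]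
        split_ifs <;> omega
      · have : 0 < (Finset.univ.filter fun z => f z = k).card := by
          by_cases h2 : k = 2
          · rw [h2, hc2]
            omega
          · obtain ⟨i, rfl⟩ := Nat.exists_eq_add_of_le' (show 3 ≤ k by omega)
            rw [hc3 i (by omega)]
            have := hm.pos ⟨g + i, by omega⟩
            have e : (⟨g + i, by omega⟩ : Fin ℓ).succ = ⟨g + 1 + i, by omega⟩ := by
              ext
              simp only [Fin.succ_mk]
              omega
            rwa [e] at this
        obtain ⟨z, hz'⟩ := Finset.card_pos.1 this
        exact ⟨z, by simpa using hz'⟩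
      · refine Or.inr (Or.inr (Or.inl ⟨K - m 0, g, by omega, hg1, hgl, by omega, by omega, ?_⟩))
        rw [ofIdx_type_list, htail]
        simp only [hf0, hf1, e0, e1, hfz, List.map_cons]
        rw [show m 0 + (K - m 0) = K by omega,
          show segSum m 1 (g + 1) - (K - m 0) = segSum m 0 (g + 1) - K by omega]
        simp
      · rw [ofIdx_rel]
        have := hgap x
        have := hgap y
        simp only [f]
        refine or_congr Iff.rfl ?_
        split_ifs <;> omega

/-! ### Contractions of level functions -/

/-- The preorder of `B` is a contraction of the partial order given by the level function `lam`,
expressed through block indices. -/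
structure LevelContraction {n ℓ : ℕ} (B : SkewedBinaryPartition n) (m : Fin (ℓ + 1) → ℕ) (K : ℕ)
    (lam : Fin (n + 1) → ℕ) : Prop where
  level : IsLevel m K lam
  le : ∀ x y, lam x < lam y → B.idx x < B.idx y ∨ (B.idx x = B.idx y ∧ B.HomogAt (B.idx x))
  spread : ∀ x, B.HomogAt (B.idx x) → ∃ u v, B.idx u = B.idx x ∧ B.idx v = B.idx x ∧ lam u < lam v
  comp : ∀ x y, B.idx x < B.idx y → ¬ B.HomogAt (B.idx x) → ¬ B.HomogAt (B.idx y) → lam x < lam y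

/-- The partial order given by a level function is layered. -/
theorem level_rel_eq_layerRel {α : Type*} (lam : α → ℕ) :
    (fun x y => x = y ∨ lam x < lam y) = layerRel (fun x => (lam x : ℚ)) (fun _ => False) := by
  funext x y
  simp [layerRel]

/-- The `Refines` criterion applied to level orders. For two distinct elements of a homogeneous
block the first alternative of `spread` fails, because a level order is antisymmetric. -/
theorem mem_SBP_iff {n ℓ : ℕ} {m : Fin (ℓ + 1) → ℕ} (hm : IsMultiplicityVector n m)
    (B : SkewedBinaryPartition n) : B ∈ SBP n m ↔ ∃ K lam, LevelContraction B m K lam := by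
  constructor
  · rintro ⟨A, hA, hc⟩
    obtain ⟨K, lam, hl, hrel⟩ := exists_isLevel hm hA
    have hAr : A.rel = fun x y => x = y ∨ lam x < lam y := by
      funext x y
      exact propext (hrel x y)
    rw [hAr, level_rel_eq_layerRel] at hc
    have hR := hc.refines (by
      intro a b h1 h2
      rcases h1 with h1 | h1 | h1
      · exact h1
      · exact absurd h2 (layerRel_not_symm_iff (f := fun x => (lam x : ℚ)).2 h1).2
      · exact h1.2.elim)
    rw [← level_rel_eq_layerRel] at hR
    refine ⟨K, lam, hl, fun x y hxy => ?_, fun x hx => ?_, fun x y hxy hx hy => ?_⟩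
    · rcases B.rel_iff.1 (hR.le x y (Or.inr hxy)) with rfl | h
      · omega
      · exact h
    · obtain ⟨y, hne, hy⟩ := B.exists_ne_of_homogAt hx
      rcases hR.spread x y (B.rel_iff.2 (Or.inr (Or.inr ⟨hy.symm, hx⟩)))
        (B.rel_iff.2 (Or.inr (Or.inr ⟨hy, hy ▸ hx⟩))) with ⟨h1, h2⟩ | ⟨u, v, hu, hv, h1, h2⟩
      · exfalso
        rcases h1 with h1 | h1
        · exact hne h1.symm
        · rcases h2 with h2 | h2
          · exact hne h2
          · omega
      · refine ⟨u, v, le_antisymm (B.idx_le_of_rel hu.2) (B.idx_le_of_rel hu.1),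
          le_antisymm (B.idx_le_of_rel hv.2) (B.idx_le_of_rel hv.1), ?_⟩
        rcases h1 with h1 | h1
        · exact absurd (Or.inl h1.symm) h2
        · exact h1
    · rcases hR.comp x y (B.rel_iff.2 (Or.inr (Or.inl hxy))) (B.trivial_class_iff.2 hx)
        (B.trivial_class_iff.2 hy) with rfl | h
      · omega
      · exact h
  · rintro ⟨K, lam, hl, hle, hspread, hcomp⟩
    obtain ⟨A, hA, hrel⟩ := hl.exists_partition hm
    refine ⟨A, hA, ?_⟩
    have hAr : A.rel = fun x y => x = y ∨ lam x < lam y := by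
      funext x y
      exact propext (hrel x y)
    rw [hAr, level_rel_eq_layerRel]
    refine Refines.isContraction B.rel_trans _ _ ?_
    rw [← level_rel_eq_layerRel]
    refine ⟨fun x y hxy => ?_, fun x y hxy hyx => ?_, fun x y hxy hx hy => ?_⟩
    · rcases hxy with hxy | hxy
      · exact B.rel_iff.2 (Or.inl hxy)
      · exact B.rel_iff.2 (Or.inr (hle x y hxy))
    · have heq := le_antisymm (B.idx_le_of_rel hxy) (B.idx_le_of_rel hyx)
      rcases B.rel_iff.1 hxy with rfl | h | h
      · exact Or.inl ⟨Or.inl rfl, Or.inl rfl⟩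
      · omega
      · obtain ⟨u, v, hu, hv, huv⟩ := hspread x h.2
        have equiv : ∀ {w}, B.idx w = B.idx x → B.rel x w ∧ B.rel w x := fun hw =>
          ⟨B.rel_iff.2 (Or.inr (Or.inr ⟨hw.symm, h.2⟩)),
            B.rel_iff.2 (Or.inr (Or.inr ⟨hw, hw ▸ h.2⟩))⟩
        refine Or.inr ⟨u, v, equiv hu, equiv hv, Or.inr huv, ?_⟩
        rintro (h | h)
        · rw [h] at huv
          omega
        · omega
    · rw [B.trivial_class_iff] at hx hy
      rcases B.rel_iff.1 hxy with h | h | h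
      · exact Or.inl h
      · exact Or.inr (hcomp x y h hx hy)
      · exact absurd h.2 hx

/-! ### Necessity of the conditions -/

namespace LevelContraction

variable {n ℓ : ℕ} {B : SkewedBinaryPartition n} {m : Fin (ℓ + 1) → ℕ} {K : ℕ}
  {lam : Fin (n + 1) → ℕ}

theorem idx_le (h : LevelContraction B m K lam) {x y : Fin (n + 1)} (hxy : lam x < lam y) :
    B.idx x ≤ B.idx y := by
  rcases h.le x y hxy with h | h <;> omega

/-- In the situation of `a_i`, `i ≥ 1`, the lowest levels stay in the first two blocks. -/
theorem idx_le_one (h : LevelContraction B m K lam) (h1 : ∀ z, lam z = 1 ↔ z = 0)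
    {z : Fin (n + 1)} (hz : lam z ≤ 1) : B.idx z ≤ 1 := by
  have h0 := B.idx_zero_le
  by_cases hz1 : lam z = 1
  · rw [(h1 z).1 hz1]
    exact h0
  · have := h.idx_le (x := z) (y := 0) (by rw [(h1 0).2 rfl]; omega)
    omega

theorem lt_countBelow_two (h : LevelContraction B m K lam) (hK : m 0 < K)
    (h1 : ∀ z, lam z = 1 ↔ z = 0) : K < B.countBelow 2 := by
  have hc := h.level.count 0
  rw [segSum_one, max_eq_right hK.le] at hc
  have : K + 1 ≤ B.countBelow 2 := by
    rw [← hc]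
    refine Finset.card_le_card fun z hz => ?_
    simp only [Finset.mem_filter, Finset.mem_univ, true_and] at hz ⊢
    have := h.idx_le_one h1 hz
    omega
  omega

/-- If all levels are at least `1`, then every homogeneous block contains an element of level at
least `2`. -/
theorem exists_two_le (h : LevelContraction B m K lam) (h1 : ∀ z, 1 ≤ lam z) {x : Fin (n + 1)}
    (hx : B.HomogAt (B.idx x)) : ∃ v, B.idx v = B.idx x ∧ 2 ≤ lam v := by
  obtain ⟨u, v, -, hv, huv⟩ := h.spread x hx
  have := h1 u
  exact ⟨v, hv, by omega⟩

/-- When 0 shares level 1: if its block is homogeneous, that block contains an element of level at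
least 2, and `x` lies beyond it; otherwise `comp` places `x` strictly above 0. When K > m_0, the
levels up to 1 are confined to the first two blocks. -/
theorem two_le_lam (h : LevelContraction B m K lam) {x : Fin (n + 1)} (hx : 2 ≤ B.idx x)
    (hH : ¬ B.HomogAt (B.idx x)) : 2 ≤ lam x := by
  have h0 := B.idx_zero_le
  rcases h.level.kind with ⟨-, hl0, hl1⟩ | ⟨-, -, hl1⟩
  · have hlx := hl1 x
    by_contra hlt
    by_cases hz : B.HomogAt (B.idx 0)
    · obtain ⟨v, hv, hv2⟩ := h.exists_two_le hl1 hz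
      have := h.idx_le (x := x) (y := v) (by omega)
      omega
    · have := h.comp 0 x (by omega) hz hH
      omega
  · by_contra hlt
    have := h.idx_le_one hl1 (z := x) (by omega)
    omega

/-- Lower levels than that of `x` lie in strictly earlier blocks and higher ones in strictly later
blocks, so the block is caught between two consecutive cuts. -/
theorem fits_of_not_homogAt (hm : IsMultiplicityVector n m) (h : LevelContraction B m K lam)
    {x : Fin (n + 1)} (hx : 2 ≤ B.idx x) (hH : ¬ B.HomogAt (B.idx x)) :
    Fits m B.type (lam x - 1) (B.idx x - 1) := by
  have h2 := h.two_le_lam hx hH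
  have hlast := h.level.le_last hm x
  have hlt := B.idx_lt x
  obtain ⟨i, hi⟩ := Nat.exists_eq_add_of_le' h2
  obtain ⟨j, hj⟩ := Nat.exists_eq_add_of_le' hx
  rw [B.fits_iff]
  have e1 : lam x - 1 = i + 1 := by omega
  have e2 : B.idx x - 1 = j + 1 := by omega
  rw [e1, e2]
  have c1 := h.level.count i
  have c2 := h.level.count (i + 1)
  have s1 : (Finset.univ.filter fun z => lam z ≤ i + 1).card ≤ B.countBelow (j + 1 + 1) := by
    refine Finset.card_le_card fun z hz => ?_
    simp only [Finset.mem_filter, Finset.mem_univ, true_and] at hz ⊢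
    rcases h.le z x (by omega) with h' | h'
    · omega
    · exact absurd (h'.1 ▸ h'.2) hH
  have s2 : B.countBelow (j + 1 + 2) ≤ (Finset.univ.filter fun z => lam z ≤ i + 1 + 1).card := by
    refine Finset.card_le_card fun z hz => ?_
    simp only [Finset.mem_filter, Finset.mem_univ, true_and] at hz ⊢
    by_contra hlam
    rcases h.le x z (by omega) with h' | h'
    · omega
    · exact hH h'.2
  have s3 : B.countBelow (j + 1 + 1) < B.countBelow (j + 1 + 2) := by
    refine Finset.card_lt_card ⟨fun z hz => ?_, fun hsub => ?_⟩
    · simp only [Finset.mem_filter, Finset.mem_univ, true_and] at hz ⊢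
      omega
    · have := hsub (Finset.mem_filter.2 ⟨Finset.mem_univ x, by omega⟩)
      simp only [Finset.mem_filter, Finset.mem_univ, true_and] at this
      omega
  -- K cannot be the larger term in the upper cut: both cuts would then equal K + 1 and leave no
  -- room for the nonempty block.
  refine ⟨⟨by omega, by omega⟩, ⟨by omega, by omega⟩, ?_, s3, ?_⟩ <;> omega

/-- The block meets two levels, so the cut after the lower one falls strictly inside it, whereas no
m_0 + ⋯ + m_a lies strictly between consecutive partial sums. -/
theorem not_fits_of_homogAt (h : LevelContraction B m K lam) {x : Fin (n + 1)}
    (hx : 2 ≤ B.idx x) (hH : B.HomogAt (B.idx x)) (i : ℕ) :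
    ¬ Fits m B.type i (B.idx x - 1) := by
  obtain ⟨u, v, hu, hv, huv⟩ := h.spread x hH
  obtain ⟨j, hj⟩ := Nat.exists_eq_add_of_le' hx
  have e2 : B.idx x - 1 = j + 1 := by omega
  rw [B.fits_iff, e2]
  rintro ⟨-, -, f1, f2, f3⟩
  have hu1 : 1 ≤ lam u := by
    rcases h.level.kind with ⟨-, -, hl1⟩ | ⟨-, -, hl1⟩
    · exact hl1 u
    · by_contra hlt
      have := h.idx_le_one hl1 (z := u) (by omega)
      omega
  obtain ⟨a, ha⟩ := Nat.exists_eq_add_of_le' hu1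
  have c1 := h.level.count a
  have s1 : B.countBelow (j + 1 + 1) < (Finset.univ.filter fun z => lam z ≤ a + 1).card := by
    refine Finset.card_lt_card ⟨fun z hz => ?_, fun hsub => ?_⟩
    · simp only [Finset.mem_filter, Finset.mem_univ, true_and] at hz ⊢
      by_contra hlam
      have := h.idx_le (x := u) (y := z) (by omega)
      omega
    · have := hsub (Finset.mem_filter.2 ⟨Finset.mem_univ u, by omega⟩)
      simp only [Finset.mem_filter, Finset.mem_univ, true_and] at this
      omega
  have s2 : (Finset.univ.filter fun z => lam z ≤ a + 1).card < B.countBelow (j + 1 + 2) := by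
    refine Finset.card_lt_card ⟨fun z hz => ?_, fun hsub => ?_⟩
    · simp only [Finset.mem_filter, Finset.mem_univ, true_and] at hz ⊢
      have := h.idx_le (x := z) (y := v) (by omega)
      omega
    · have := hsub (Finset.mem_filter.2 ⟨Finset.mem_univ v, by omega⟩)
      simp only [Finset.mem_filter, Finset.mem_univ, true_and] at this
      omega
  -- This ensures that the cut inside the block comes from a partial sum of `m` and not from K.
  have hK : K ≤ segSum m 0 (a + 1) ∨ K < B.countBelow (j + 1 + 1) := by
    rcases h.level.kind with ⟨hK, -, -⟩ | ⟨hK, -, hl1⟩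
    · left
      rw [hK, ← segSum_one m]
      exact segSum_mono m (by omega)
    · right
      exact lt_of_lt_of_le (h.lt_countBelow_two hK hl1) (B.countBelow_mono (by omega))
  have hmono : segSum m 0 (a + 1) ≤ segSum m 0 i ∨ segSum m 0 (i + 1) ≤ segSum m 0 (a + 1) := by
    rcases Nat.lt_or_ge a i with hai | hai
    · exact Or.inl (segSum_mono m hai)
    · exact Or.inr (segSum_mono m (by omega))
  omega

end LevelContraction

theorem Fits.unique {ℓ p : ℕ} {m : Fin (ℓ + 1) → ℕ} {b : Fin (p + 2) → Entry} {i i' j : ℕ}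
    (h : Fits m b i j) (h' : Fits m b i' j) : i = i' := by
  obtain ⟨-, -, h1, h2, h3⟩ := h
  obtain ⟨-, -, h4, -, h6⟩ := h'
  rcases Nat.lt_trichotomy i i' with hlt | heq | hlt
  · have := segSum_mono m (show i + 1 ≤ i' from hlt)
    omega
  · exact heq
  · have := segSum_mono m (show i' + 1 ≤ i from hlt)
    omega

namespace LevelContraction

variable {n ℓ : ℕ} {B : SkewedBinaryPartition n} {m : Fin (ℓ + 1) → ℕ} {K : ℕ}
  {lam : Fin (n + 1) → ℕ}

/-- A block fitting i is non-homogeneous and has an element of level i + 1, and `comp` forbids equal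
levels in two such blocks. -/
theorem fits_unique (hm : IsMultiplicityVector n m) (h : LevelContraction B m K lam) {i j j' : ℕ}
    (hj : Fits m B.type i j) (hj' : Fits m B.type i j') : j = j' := by
  have key : ∀ {j}, Fits m B.type i j →
      ∃ x, B.idx x = j + 1 ∧ ¬ B.HomogAt (B.idx x) ∧ lam x = i + 1 := by
    intro j hj
    have hj1 := hj.2.1
    obtain ⟨x, hx⟩ := B.exists_idx_eq (k := j + 1) (by omega) (by omega)
    have e : B.idx x - 1 = j := by omega
    have hH : ¬ B.HomogAt (B.idx x) := fun hH =>
      h.not_fits_of_homogAt (by omega) hH i (by rwa [e])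
    have hf := h.fits_of_not_homogAt hm (x := x) (by omega) hH
    rw [e] at hf
    have := hf.unique hj
    have := h.two_le_lam (x := x) (by omega) hH
    exact ⟨x, hx, hH, by omega⟩
  obtain ⟨x, hx, hxH, hxl⟩ := key hj
  obtain ⟨y, hy, hyH, hyl⟩ := key hj'
  rcases Nat.lt_trichotomy (B.idx x) (B.idx y) with hlt | heq | hlt
  · have := h.comp x y hlt hxH hyH
    omega
  · omega
  · have := h.comp y x hlt hyH hxH
    omega

/-- If K = m_0, some element of level at least 2 lies in the first three blocks, and so do all m_0 +
1 elements of level at most 1. If K > m_0, the first two blocks already suffice. -/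
theorem lt_countBelow_three (hm : IsMultiplicityVector n m) (h : LevelContraction B m K lam) :
    m 0 + 1 < B.countBelow 3 := by
  rcases h.level.kind with ⟨hK, hl0, hl1⟩ | ⟨hK, -, hl1⟩
  · obtain ⟨v, hv, hv2⟩ : ∃ v, B.idx v ≤ 2 ∧ 2 ≤ lam v := by
      have h01 := B.idx_zero_le
      by_cases hz : B.HomogAt (B.idx 0)
      · obtain ⟨v, hv, hv2⟩ := h.exists_two_le hl1 hz
        exact ⟨v, by omega, hv2⟩
      · by_cases hp : 0 < B.p
        · obtain ⟨x, hx⟩ := B.exists_idx_eq (k := 2) le_rfl (by omega)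
          by_cases hH : B.HomogAt (B.idx x)
          · obtain ⟨v, hv, hv2⟩ := h.exists_two_le hl1 hH
            exact ⟨v, by omega, hv2⟩
          · exact ⟨x, hx.le, h.two_le_lam hx.ge hH⟩
        · by_contra hno
          push Not at hno
          have hc := h.level.count 0
          rw [segSum_one, hK, max_self, Finset.filter_true_of_mem] at hc
          · have := hm.zero_lt
            simp only [Finset.card_univ, Fintype.card_fin] at hc
            omega
          · intro z _
            have := hno z (by have := B.idx_lt z; omega)
            omega
    have hc := h.level.count 0
    rw [segSum_one, hK, max_self] at hc
    rw [← hc]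
    refine Finset.card_lt_card ⟨fun z hz => ?_, fun hsub => ?_⟩
    · simp only [Finset.mem_filter, Finset.mem_univ, true_and] at hz ⊢
      have := h.idx_le (x := z) (y := v) (by omega)
      omega
    · have := hsub (Finset.mem_filter.2 ⟨Finset.mem_univ v, by omega⟩)
      simp only [Finset.mem_filter, Finset.mem_univ, true_and] at this
      omega
  · have h1 := h.lt_countBelow_two hK hl1
    have h2 := B.countBelow_mono (show 2 ≤ 3 by omega)
    omega

/-- If K > m_0, both sides fail: the first two blocks are too large, and an element below 0 excludes
0 from B_{-1}. If K = m_0, a homogeneous B_0 containing 0 would bring in a level above 1 and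
overshoot m_0 + 1, while a non-homogeneous one leaves nothing that could be below 0 in B_{-1}. -/
theorem countBelow_two_iff (h : LevelContraction B m K lam) :
    (1 < B.countBelow 2 ∧ B.countBelow 2 ≤ m 0 + 1) ↔ B.idx 0 = 0 := by
  have h01 := B.idx_zero_le
  rcases h.level.kind with ⟨hK, hl0, hl1⟩ | ⟨hK, -, hl1⟩
  · have hc := h.level.count 0
    rw [segSum_one, hK, max_self] at hc
    constructor
    · rintro ⟨hlt, hle⟩
      by_contra h0
      obtain ⟨x, hx, hne⟩ := Finset.exists_mem_ne hlt 0
      simp only [Finset.mem_filter, Finset.mem_univ, true_and] at hx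
      have hH : B.HomogAt (B.idx 0) := by
        by_contra hH
        have h1 : B.idx 0 = 1 := by omega
        have hx0 : B.idx x = 0 := by
          by_contra hx0
          rw [h1] at hH
          exact hH (B.homogAt_of_ne (show B.idx x = 1 by omega) h1 hne)
        have := h.comp x 0 (by omega) (hx0 ▸ B.not_homogAt_zero) hH
        have := hl1 x
        omega
      obtain ⟨v, hv, hv2⟩ := h.exists_two_le hl1 hH
      have : m 0 + 1 < B.countBelow 2 := by
        rw [← hc]
        refine Finset.card_lt_card ⟨fun z hz => ?_, fun hsub => ?_⟩
        · simp only [Finset.mem_filter, Finset.mem_univ, true_and] at hz ⊢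
          have := h.idx_le (x := z) (y := v) (by omega)
          omega
        · have := hsub (Finset.mem_filter.2 ⟨Finset.mem_univ v, by omega⟩)
          simp only [Finset.mem_filter, Finset.mem_univ, true_and] at this
          omega
      omega
    · intro h0
      constructor
      · have hz : (0 : Fin (n + 1)) ∈ B.block 0 := B.mem_block_iff.2 (by simpa using h0)
        refine lt_of_lt_of_le (B.zero_mem_first hz).1 (Finset.card_le_card fun z hz => ?_)
        rw [B.mem_block_iff] at hz
        simp only [Fin.val_zero] at hz
        simp [hz]
      · rw [← hc]
        refine Finset.card_le_card fun z hz => ?_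
        simp only [Finset.mem_filter, Finset.mem_univ, true_and] at hz ⊢
        have := B.idx_ne_one h0 z
        by_contra hlam
        rcases h.le 0 z (by omega) with h' | h'
        · omega
        · exact B.not_homogAt_zero (h0 ▸ h'.2)
  · have hlt := h.lt_countBelow_two hK hl1
    refine ⟨fun h => by omega, fun h0 => ?_⟩
    exfalso
    have hc := h.level.count 0
    rw [segSum_one, max_eq_right hK.le] at hc
    obtain ⟨x, hx, hne⟩ := Finset.exists_mem_ne
      (s := Finset.univ.filter fun z => lam z ≤ 0 + 1) (by omega) 0
    simp only [Finset.mem_filter, Finset.mem_univ, true_and] at hx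
    have hx1 : lam x ≠ 1 := fun h => hne ((hl1 x).1 h)
    have hz1 := (hl1 0).2 rfl
    rcases h.le x 0 (by omega) with h' | h'
    · omega
    · rw [h'.1, h0] at h'
      exact B.not_homogAt_zero h'.2

end LevelContraction

/-! ### Sufficiency of the conditions -/

namespace SkewedBinaryPartition

variable {n : ℕ} (B : SkewedBinaryPartition n)

/-- The position of `z` in a list of the elements of `[0,n]` that is sorted by block indices. -/
noncomputable def pos (z : Fin (n + 1)) : ℕ := ((Tuple.sort B.idx).symm z).val

theorem pos_le (z : Fin (n + 1)) : B.pos z ≤ n := by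
  have := ((Tuple.sort B.idx).symm z).isLt
  unfold pos
  omega

theorem exists_pos_eq {q : ℕ} (hq : q ≤ n) : ∃ z, B.pos z = q :=
  ⟨Tuple.sort B.idx ⟨q, by omega⟩, by simp [pos]⟩

theorem idx_le_of_pos_le {x y : Fin (n + 1)} (h : B.pos x ≤ B.pos y) : B.idx x ≤ B.idx y := by
  have := Tuple.monotone_sort B.idx (show (Tuple.sort B.idx).symm x ≤ (Tuple.sort B.idx).symm y from h)
  simpa using this

theorem card_pos_le {k : ℕ} (hk : k ≤ n) :
    (Finset.univ.filter fun z => B.pos z ≤ k).card = k + 1 := by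
  have h1 : (Finset.univ.filter fun z => B.pos z ≤ k) =
      (Finset.univ.filter fun i : Fin (n + 1) => i.val ≤ k).map
        (Tuple.sort B.idx).toEmbedding := by
    ext z
    rw [Finset.mem_map_equiv, Finset.mem_filter, Finset.mem_filter]
    simp [pos]
  have h2 : (Finset.univ.filter fun i : Fin (n + 1) => i.val ≤ k) =
      Finset.Iic ⟨k, by omega⟩ := by
    ext i
    simp [Fin.le_def]
  rw [h1, Finset.card_map, h2, Fin.card_Iic]

theorem pos_lt_countBelow_iff {z : Fin (n + 1)} {c : ℕ} : B.pos z < B.countBelow c ↔ B.idx z < c := by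
  have hcard := B.card_pos_le (B.pos_le z)
  constructor
  · intro h
    by_contra hlt
    have : B.countBelow c < (Finset.univ.filter fun w => B.pos w ≤ B.pos z).card := by
      refine Finset.card_lt_card ⟨fun w hw => ?_, fun hsub => ?_⟩
      · simp only [Finset.mem_filter, Finset.mem_univ, true_and] at hw ⊢
        by_contra hlt'
        have := B.idx_le_of_pos_le (x := z) (y := w) (by omega)
        omega
      · have := hsub (Finset.mem_filter.2 ⟨Finset.mem_univ z, le_rfl⟩)
        simp only [Finset.mem_filter, Finset.mem_univ, true_and] at this
        omega
    omega
  · intro h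
    have : (Finset.univ.filter fun w => B.pos w ≤ B.pos z).card ≤ B.countBelow c := by
      refine Finset.card_le_card fun w hw => ?_
      simp only [Finset.mem_filter, Finset.mem_univ, true_and] at hw ⊢
      have := B.idx_le_of_pos_le hw
      omega
    omega

theorem pos_lt_of_idx_lt {x y : Fin (n + 1)} (h : B.idx x < B.idx y) : B.pos x < B.pos y := by
  by_contra hlt
  have := B.idx_le_of_pos_le (not_lt.1 hlt)
  omega

theorem countBelow_le (c : ℕ) : B.countBelow c ≤ n + 1 := by
  unfold countBelow
  exact (Finset.card_le_univ _).trans (by simp)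

theorem countBelow_lt_succ (x : Fin (n + 1)) :
    B.countBelow (B.idx x) < B.countBelow (B.idx x + 1) := by
  have h1 : B.pos x < B.countBelow (B.idx x + 1) := B.pos_lt_countBelow_iff.2 (by omega)
  have h2 : ¬ B.pos x < B.countBelow (B.idx x) := fun h => by
    have := B.pos_lt_countBelow_iff.1 h
    omega
  omega

/-- The first and the last element of a block in the sorted list. -/
theorem exists_ends (x : Fin (n + 1)) : ∃ u v, B.idx u = B.idx x ∧ B.idx v = B.idx x ∧
    B.pos u = B.countBelow (B.idx x) ∧ B.pos v + 1 = B.countBelow (B.idx x + 1) := by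
  have hlt := B.countBelow_lt_succ x
  have hle := B.countBelow_le (B.idx x + 1)
  obtain ⟨u, hu⟩ := B.exists_pos_eq (q := B.countBelow (B.idx x)) (by omega)
  obtain ⟨v, hv⟩ := B.exists_pos_eq (q := B.countBelow (B.idx x + 1) - 1) (by omega)
  have mid : ∀ w, B.countBelow (B.idx x) ≤ B.pos w → B.pos w < B.countBelow (B.idx x + 1) →
      B.idx w = B.idx x := by
    intro w h1 h2
    have h3 := B.pos_lt_countBelow_iff.1 h2
    have h4 : ¬ B.idx w < B.idx x := fun h => by
      have := B.pos_lt_countBelow_iff.2 h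
      omega
    omega
  exact ⟨u, v, mid u (by omega) (by omega), mid v (by omega) (by omega), hu, by omega⟩

end SkewedBinaryPartition

/-- Cutting the sorted list at the positions `max (m_0 + ⋯ + m_i) K`. -/
theorem exists_cut {n ℓ : ℕ} {m : Fin (ℓ + 1) → ℕ} (hm : IsMultiplicityVector n m)
    (B : SkewedBinaryPartition n) (K : ℕ) : ∃ L : Fin (n + 1) → ℕ,
      ∀ z i, L z ≤ i ↔ B.pos z ≤ max (segSum m 0 (i + 1)) K := by
  classical
  have hex : ∀ z, ∃ i, B.pos z ≤ max (segSum m 0 (i + 1)) K := fun z =>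
    ⟨ℓ, by rw [hm.segSum_eq le_rfl]; exact (B.pos_le z).trans (le_max_left _ _)⟩
  refine ⟨fun z => Nat.find (hex z), fun z i => ?_⟩
  rw [Nat.find_le_iff]
  constructor
  · rintro ⟨k, hk, h⟩
    exact h.trans (max_le_max (segSum_mono m (by omega)) le_rfl)
  · intro h
    exact ⟨i, le_rfl, h⟩

/-! ### How blocks meet the segments of the cut list -/

section Cut

variable {n ℓ : ℕ} {m : Fin (ℓ + 1) → ℕ} {B : SkewedBinaryPartition n} {K : ℕ}
  {L : Fin (n + 1) → ℕ}

theorem cut_le_of_idx_lt (hL : ∀ z i, L z ≤ i ↔ B.pos z ≤ max (segSum m 0 (i + 1)) K)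
    {x y : Fin (n + 1)} (h : B.idx x < B.idx y) : L x ≤ L y :=
  (hL x _).2 ((B.pos_lt_of_idx_lt h).le.trans ((hL y _).1 le_rfl))

theorem idx_le_of_cut_lt (hL : ∀ z i, L z ≤ i ↔ B.pos z ≤ max (segSum m 0 (i + 1)) K)
    {x y : Fin (n + 1)} (h : L x < L y) : B.idx x ≤ B.idx y := by
  by_contra hlt
  have := cut_le_of_idx_lt hL (not_le.1 hlt)
  omega

/-- For both choices of K the block starts after position K, so only the partial sums of `m` matter
and (*) names the segment. -/
theorem cut_eq_of_fits (hL : ∀ z i, L z ≤ i ↔ B.pos z ≤ max (segSum m 0 (i + 1)) K)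
    (hK : K = m 0 ∨ K + 1 = B.countBelow 2) {x : Fin (n + 1)} (hx : 2 ≤ B.idx x) {i : ℕ}
    (hf : Fits m B.type i (B.idx x - 1)) : L x = i := by
  obtain ⟨j, hj⟩ := Nat.exists_eq_add_of_le' hx
  have e : B.idx x - 1 = j + 1 := by omega
  rw [B.fits_iff, e] at hf
  obtain ⟨⟨hi, -⟩, -, f1, f2, f3⟩ := hf
  have p1 : ¬ B.pos x < B.countBelow (j + 1 + 1) := fun h => by
    have := B.pos_lt_countBelow_iff.1 h
    omega
  have p2 : B.pos x < B.countBelow (j + 1 + 2) := B.pos_lt_countBelow_iff.2 (by omega)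
  have hK' : K < B.countBelow (j + 1 + 1) := by
    rcases hK with hK | hK
    · have : segSum m 0 1 ≤ segSum m 0 i := segSum_mono m hi
      rw [segSum_one] at this
      omega
    · have := B.countBelow_mono (show 2 ≤ j + 1 + 1 by omega)
      omega
  obtain ⟨k, rfl⟩ := Nat.exists_eq_add_of_le' hi
  have h1 := (hL x (k + 1)).2 (by omega)
  have h2 : ¬ L x ≤ k := fun h => by
    have := (hL x k).1 h
    omega
  omega

/-- If the first and last elements of the block lay in one segment, the block would fit there.
Segment 0 is excluded because the last position exceeds both m_0 and K; for K = m_0 this is the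
first half of condition 2. -/
theorem exists_cut_lt (hm : IsMultiplicityVector n m)
    (hL : ∀ z i, L z ≤ i ↔ B.pos z ≤ max (segSum m 0 (i + 1)) K)
    (hK : K = m 0 ∨ (m 0 < K ∧ K + 1 = B.countBelow 2)) (h3 : m 0 + 1 < B.countBelow 3)
    {x : Fin (n + 1)} (hx : 2 ≤ B.idx x) (hno : ∀ i, ¬ Fits m B.type i (B.idx x - 1)) :
    ∃ u v, B.idx u = B.idx x ∧ B.idx v = B.idx x ∧ L u < L v := by
  obtain ⟨u, v, hu, hv, pu, pv⟩ := B.exists_ends x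
  refine ⟨u, v, hu, hv, ?_⟩
  by_contra hlt
  have hlt' := B.countBelow_lt_succ x
  have hv1 := (hL v (L u)).1 (not_lt.1 hlt)
  have hlast : L u ≤ ℓ := by
    rw [hL, hm.segSum_eq le_rfl]
    exact (B.pos_le u).trans (le_max_left _ _)
  have hmono2 := B.countBelow_mono hx
  have hmono3 := B.countBelow_mono (show 3 ≤ B.idx x + 1 by omega)
  rcases Nat.eq_zero_or_pos (L u) with h0 | hpos
  · rw [h0, segSum_one] at hv1
    omega
  · obtain ⟨i, hi⟩ : ∃ i, L u = i + 1 := ⟨L u - 1, by omega⟩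
    have hu1 : ¬ B.pos u ≤ max (segSum m 0 (i + 1)) K := fun h => by
      have := (hL u i).2 h
      omega
    refine hno (i + 1) ?_
    obtain ⟨j, hj⟩ := Nat.exists_eq_add_of_le' hx
    have e : B.idx x - 1 = j + 1 := by omega
    have hp := B.idx_lt x
    rw [B.fits_iff, e]
    rw [hi] at hv1 hlast
    rw [show B.idx x = j + 1 + 1 from hj] at pu hlt'
    rw [show B.idx x + 1 = j + 1 + 2 by omega] at pv
    replace hlt' : B.countBelow (j + 1 + 1) < B.countBelow (j + 1 + 2) := hlt'
    refine ⟨⟨by omega, hlast⟩, ⟨by omega, by omega⟩, ?_, hlt', ?_⟩ <;> omega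

theorem card_cut_le (hm : IsMultiplicityVector n m)
    (hL : ∀ z i, L z ≤ i ↔ B.pos z ≤ max (segSum m 0 (i + 1)) K) (hK : K ≤ n) (i : ℕ) :
    (Finset.univ.filter fun z => L z ≤ i).card = max (segSum m 0 (i + 1)) K + 1 := by
  simp only [hL]
  exact B.card_pos_le (max_le (hm.segSum_le _) hK)

theorem cut_lt_of_fits (hL : ∀ z i, L z ≤ i ↔ B.pos z ≤ max (segSum m 0 (i + 1)) K)
    (hK : K = m 0 ∨ K + 1 = B.countBelow 2)
    (huniq : ∀ i j j', Fits m B.type i j → Fits m B.type i j' → j = j')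
    {x y : Fin (n + 1)} (hx : 2 ≤ B.idx x) (hxy : B.idx x < B.idx y)
    (hfx : ∃ i, Fits m B.type i (B.idx x - 1)) (hfy : ∃ i, Fits m B.type i (B.idx y - 1)) :
    L x < L y := by
  obtain ⟨i, hi⟩ := hfx
  obtain ⟨i', hi'⟩ := hfy
  have h1 := cut_eq_of_fits hL hK hx hi
  have h2 := cut_eq_of_fits hL hK (by omega) hi'
  refine lt_of_le_of_ne (cut_le_of_idx_lt hL hxy) fun h => ?_
  have : i = i' := by omega
  subst this
  have := huniq _ _ _ hi hi'
  omega

end Cut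

/-- The numerical conditions produce a level function of which the preorder of `B` is a
contraction. -/
theorem exists_levelContraction {n ℓ : ℕ} {m : Fin (ℓ + 1) → ℕ} (hm : IsMultiplicityVector n m)
    {B : SkewedBinaryPartition n}
    (h1 : (1 < B.countBelow 2 ∧ B.countBelow 2 ≤ m 0 + 1) ↔ B.idx 0 = 0)
    (h2 : m 0 + 1 < B.countBelow 3)
    (huniq : ∀ i j j', Fits m B.type i j → Fits m B.type i j' → j = j')
    (hfit : ∀ x, 2 ≤ B.idx x → ¬ B.HomogAt (B.idx x) → ∃ i, Fits m B.type i (B.idx x - 1))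
    (hnofit : ∀ x, 2 ≤ B.idx x → B.HomogAt (B.idx x) → ∀ i, ¬ Fits m B.type i (B.idx x - 1)) :
    ∃ K lam, LevelContraction B m K lam := by
  have h01 := B.idx_zero_le
  have hmn := hm.zero_lt
  have hcpos : 1 ≤ B.countBelow 2 := Finset.card_pos.2 ⟨0, by
    simp only [Finset.mem_filter, Finset.mem_univ, true_and]
    omega⟩
  have fits_pos : ∀ {i j}, Fits m B.type i j → 1 ≤ i := fun h => h.1.1
  by_cases hcase : B.countBelow 2 ≤ m 0 + 1
  · obtain ⟨L, hL⟩ := exists_cut hm B (m 0)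
    have hlow : ∀ z, B.idx z ≤ 1 → L z = 0 := by
      intro z hz
      have hp : B.pos z < B.countBelow 2 := B.pos_lt_countBelow_iff.2 (by omega)
      -- Positions start at 0, so segment 0 has m_0 + 1 places, enough for the first two blocks.
      have := (hL z 0).2 (by rw [segSum_one]; omega)
      omega
    have hsplit : ∀ x y, x ≠ y → B.idx x ≤ 1 → B.idx y = 1 → False := by
      intro x y hne hx hy
      have : 1 < B.countBelow 2 := by
        refine Finset.one_lt_card.2 ⟨x, ?_, y, ?_, hne⟩ <;>
        · simp only [Finset.mem_filter, Finset.mem_univ, true_and]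
          omega
      exact B.idx_ne_one (h1.1 ⟨this, hcase⟩) y hy
    refine ⟨m 0, fun z => L z + 1, ⟨fun i => ?_, Or.inl ⟨rfl, ?_, fun z => by omega⟩⟩,
      fun x y hxy => ?_, fun x hx => ?_, fun x y hxy hx hy => ?_⟩
    · simp only [Nat.add_le_add_iff_right]
      exact card_cut_le hm hL hmn.le i
    · simp only [hlow 0 h01]
    · have hlt : L x < L y := by omega
      rcases (idx_le_of_cut_lt hL hlt).lt_or_eq with h | h
      · exact Or.inl h
      · refine Or.inr ⟨h, ?_⟩
        by_contra hH
        by_cases hx : 2 ≤ B.idx x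
        · obtain ⟨i, hi⟩ := hfit x hx hH
          have e1 := cut_eq_of_fits hL (Or.inl rfl) hx hi
          have e2 := cut_eq_of_fits hL (Or.inl rfl) (x := y) (by omega) (h ▸ hi)
          omega
        · have := hlow y (by omega)
          omega
    · by_cases hx2 : 2 ≤ B.idx x
      · obtain ⟨u, v, hu, hv, huv⟩ :=
          exists_cut_lt hm hL (Or.inl rfl) h2 hx2 (hnofit x hx2 hx)
        exact ⟨u, v, hu, hv, by omega⟩
      · exfalso
        have hx1 : B.idx x = 1 := by
          by_contra hx1
          have hx0 : B.idx x = 0 := by omega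
          exact B.not_homogAt_zero (hx0 ▸ hx)
        obtain ⟨y, hne, hy⟩ := B.exists_ne_of_homogAt hx
        exact hsplit y x hne (by omega) hx1
    · by_cases hy2 : 2 ≤ B.idx y
      · by_cases hx2 : 2 ≤ B.idx x
        · have := cut_lt_of_fits hL (Or.inl rfl) huniq hx2 hxy (hfit x hx2 hx) (hfit y hy2 hy)
          omega
        · obtain ⟨i, hi⟩ := hfit y hy2 hy
          have e1 := cut_eq_of_fits hL (Or.inl rfl) hy2 hi
          have e2 := hlow x (by omega)
          have e3 := fits_pos hi
          omega
      · exact (hsplit x y (fun h => by rw [h] at hxy; omega) (by omega) (by omega)).elim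
  · have hz : B.idx 0 = 1 := by
      by_contra h
      exact hcase (h1.2 (by omega)).2
    -- The first two blocks hold too much for a_0, so K is chosen to make segment 0 exactly B_{-1} ∪
    -- B_0; inside it 0 is then raised above the rest.
    obtain ⟨K, hK⟩ : ∃ K, K + 1 = B.countBelow 2 := ⟨B.countBelow 2 - 1, by omega⟩
    have hmK : m 0 < K := by omega
    have hKn : K ≤ n := by
      have := B.countBelow_le 2
      omega
    obtain ⟨L, hL⟩ := exists_cut hm B K
    have hlow : ∀ z, L z = 0 ↔ B.idx z ≤ 1 := by
      intro z
      have e1 := hL z 0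
      have e2 := B.pos_lt_countBelow_iff (z := z) (c := 2)
      rw [segSum_one] at e1
      omega
    let lam : Fin (n + 1) → ℕ := fun z => if z = 0 then 1 else if B.idx z ≤ 1 then 0 else L z + 1
    have lam_zero : lam 0 = 1 := by simp [lam]
    have lam_low : ∀ z, z ≠ 0 → B.idx z ≤ 1 → lam z = 0 := by
      intro z hz hz'
      simp [lam, hz, hz']
    have lam_high : ∀ z, 2 ≤ B.idx z → lam z = L z + 1 ∧ 1 ≤ L z := by
      intro z hz'
      have e1 : z ≠ 0 := by
        rintro rfl
        omega
      have e2 := hlow z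
      refine ⟨?_, by omega⟩
      simp only [lam]
      rw [if_neg e1, if_neg (by omega)]
    have lam_le_one : ∀ z, B.idx z ≤ 1 → lam z ≤ 1 := by
      intro z hz'
      by_cases e : z = 0
      · rw [e, lam_zero]
      · rw [lam_low z e hz']
        omega
    refine ⟨K, lam, ⟨fun i => ?_, Or.inr ⟨hmK, hKn, fun z => ?_⟩⟩,
      fun x y hxy => ?_, fun x hx => ?_, fun x y hxy hx hy => ?_⟩
    · rw [← card_cut_le hm hL hKn i]
      congr 1
      ext z
      simp only [Finset.mem_filter, Finset.mem_univ, true_and]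
      have e1 := hlow z
      have e2 := lam_le_one z
      have e3 := lam_high z
      omega
    · constructor
      · intro h
        by_contra hne
        have e1 := lam_low z hne
        have e3 := lam_high z
        omega
      · rintro rfl
        exact lam_zero
    · have e1 := lam_le_one x
      have e2 := lam_le_one y
      have e3 := lam_high x
      have e4 := lam_high y
      by_cases hy2 : 2 ≤ B.idx y
      · by_cases hx2 : 2 ≤ B.idx x
        · have hlt : L x < L y := by omega
          rcases (idx_le_of_cut_lt hL hlt).lt_or_eq with h | h
          · exact Or.inl h
          · refine Or.inr ⟨h, ?_⟩
            by_contra hH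
            obtain ⟨i, hi⟩ := hfit x hx2 hH
            have e1 := cut_eq_of_fits hL (Or.inr hK) hx2 hi
            have e2 := cut_eq_of_fits hL (Or.inr hK) hy2 (h ▸ hi)
            omega
        · left
          omega
      · have hx2 : B.idx x ≤ 1 := by
          by_contra h
          omega
        have hy0 : y = 0 := by
          by_contra hne
          have := lam_low y hne (by omega)
          omega
        rw [hy0] at hxy ⊢
        have hne : x ≠ 0 := by
          rintro rfl
          omega
        by_cases hx1 : B.idx x = 1
        · right
          rw [hx1, hz]
          exact ⟨rfl, B.homogAt_of_ne hx1 hz hne⟩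
        · left
          omega
    · by_cases hx2 : 2 ≤ B.idx x
      · obtain ⟨u, v, hu, hv, huv⟩ :=
          exists_cut_lt hm hL (Or.inr ⟨hmK, hK⟩) h2 hx2 (hnofit x hx2 hx)
        have e1 := lam_high u (by omega)
        have e2 := lam_high v (by omega)
        exact ⟨u, v, hu, hv, by omega⟩
      · have hx1 : B.idx x = 1 := by
          by_contra hx1
          have hx0 : B.idx x = 0 := by omega
          exact B.not_homogAt_zero (hx0 ▸ hx)
        obtain ⟨y, hne, hy⟩ := B.exists_ne_of_homogAt (x := 0) (by rwa [hz, ← hx1])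
        -- A homogeneous B_0 meets two levels: 0 at level 1 and any other element at level 0.
        exact ⟨y, 0, by omega, by omega, by rw [lam_zero, lam_low y hne (by omega)]; omega⟩
    · by_cases hy2 : 2 ≤ B.idx y
      · have e4 := lam_high y hy2
        by_cases hx2 : 2 ≤ B.idx x
        · have := cut_lt_of_fits hL (Or.inr hK) huniq hx2 hxy (hfit x hx2 hx) (hfit y hy2 hy)
          have e3 := lam_high x hx2
          omega
        · have := lam_le_one x (by omega)
          omega
      · have hy1 : B.idx y = 1 := by omega
        have hy0 : y = 0 := by
          by_contra hne
          exact hy (hy1 ▸ B.homogAt_of_ne hy1 hz hne)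
        have hne : x ≠ 0 := by
          rintro rfl
          omega
        rw [hy0, lam_zero, lam_low x hne (by omega)]
        omega

end ParkingFan

/-! ### Translation between the type conditions and block counts -/

theorem mainTheorem5 (n ℓ : ℕ) (m : Fin (ℓ + 1) → ℕ)
    (hm : ParkingFan.IsMultiplicityVector n m) (B : ParkingFan.SkewedBinaryPartition n) :
    B ∈ ParkingFan.SBP n m ↔
      ParkingFan.IsSkewedBinaryComposition n B.type ∧
      -- (1) `0 < |b_{-1}| + |b_0| ≤ m_0` iff `b_0 = 0` (the plain zero)
      ((0 < (B.type 0).abs + (B.type 1).abs ∧ (B.type 0).abs + (B.type 1).abs ≤ m 0) ↔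
        B.type 1 = .plain 0) ∧
      -- (2) `m_0 < |b_{-1}| + |b_0| + |b_1|` (without `|b_1|` when `p = 0`), and at most one `j`
      -- fits for each `i`
      (m 0 < ParkingFan.segSum (fun t => (B.type t).abs) 0 3 ∧
        ∀ i j j' : ℕ, ParkingFan.Fits m B.type i j → ParkingFan.Fits m B.type i j' → j = j') ∧
      -- (3) `b_j` is plain if `j` fits for some `i`, and starred otherwise
      (∀ j : Fin B.p,
        ((∃ i, ParkingFan.Fits m B.type i (j + 1)) → (B.type j.succ.succ).IsPos) ∧
        ((¬ ∃ i, ParkingFan.Fits m B.type i (j + 1)) → (B.type j.succ.succ).IsPosStar)) := by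
  have e2 := B.countBelow_two
  have e3 := B.countBelow_eq (k := 3) (by omega)
  have c1 : (0 < (B.type 0).abs + (B.type 1).abs ∧ (B.type 0).abs + (B.type 1).abs ≤ m 0) ↔
      (1 < B.countBelow 2 ∧ B.countBelow 2 ≤ m 0 + 1) := by
    omega
  have c2 : m 0 < ParkingFan.segSum (fun t => (B.type t).abs) 0 3 ↔ m 0 + 1 < B.countBelow 3 := by
    omega
  rw [ParkingFan.mem_SBP_iff hm, c1, c2, B.type_one_eq_plain_zero_iff]
  simp only [B.isPos_iff, B.isPosStar_iff]
  constructor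
  · rintro ⟨K, lam, h⟩
    refine ⟨B.isSkewedBinaryComposition_type, h.countBelow_two_iff,
      ⟨h.lt_countBelow_three hm, fun i j j' => h.fits_unique hm⟩, fun j => ?_⟩
    obtain ⟨x, hx⟩ := B.exists_idx_eq (k := j.val + 2) (by omega) (by omega)
    have e : B.idx x - 1 = j.val + 1 := by omega
    rw [← hx, ← e]
    constructor
    · rintro ⟨i, hi⟩ hH
      exact h.not_fits_of_homogAt (by omega) hH i hi
    · intro hno
      by_contra hH
      exact hno ⟨_, h.fits_of_not_homogAt hm (by omega) hH⟩
  · rintro ⟨-, h1, ⟨h2, huniq⟩, h3⟩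
    have at_idx : ∀ x, 2 ≤ B.idx x →
        ((∃ i, ParkingFan.Fits m B.type i (B.idx x - 1)) → ¬ B.HomogAt (B.idx x)) ∧
        ((¬ ∃ i, ParkingFan.Fits m B.type i (B.idx x - 1)) → B.HomogAt (B.idx x)) := by
      intro x hx
      have hlt := B.idx_lt x
      have h := h3 ⟨B.idx x - 2, by omega⟩
      have e4 : B.idx x - 2 + 1 = B.idx x - 1 := by omega
      have e5 : B.idx x - 2 + 2 = B.idx x := by omega
      simp only [e4, e5] at h
      exact h
    refine ParkingFan.exists_levelContraction hm h1 h2 huniq (fun x hx hH => ?_)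
      (fun x hx hH i hi => (at_idx x hx).1 ⟨i, hi⟩ hH)
    by_contra hno
    exact hH ((at_idx x hx).2 hno)
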